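/- Let $k$ be a field of characteristic $0$, let $q\in k^\times$ be not a root of unity, and let $c\in k$, $c\neq 0$. Let $U_q(\mathfrak{sl}_2)$ be the $k$-algebra generated by $E,F,K^{\pm1}$ with $KE=q^2EK$, $KF=q^{-2}FK$, $EF-FE=\frac{K-K^{-1}}{q-q^{-1}}$, with coproduct $\Delta E=E\otimes K+1\otimes E$, $\Delta F=F\otimes 1+K^{-1}\otimes F$, $\Delta K^{\pm1}=K^{\pm1}\otimes K^{\pm1}$, counit $\varepsilon(E)=\varepsilon(F)=0$, $\varepsilon(K^{\pm1})=1$, and antipode $S(E)=-EK^{-1}$, $S(F)=-KF$, $S(K^{\pm1})=K^{\mp1}$. It acts on itself by $\mathrm{ad}_a b=\sum a_{(1)}\,b\,S(a_{(2)})$. Let $V_{2\pi}$ be its $3$-dimensional module with basis $v_2,v_0,v_{-2}$ and action $Kv_i=q^iv_i$, $Ev_2=0$, $Ev_0=-(q+q^{-1})v_2$, $Ev_{-2}=v_0$, $Fv_2=-v_0$, $Fv_0=(q+q^{-1})v_{-2}$, $Fv_{-2}=0$, equipped with the invariant bilinear form whose only nonzero values on basis vectors are $\langle v_2,v_{-2}\rangle=c$,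 $\langle v_0,v_0\rangle=q^{-3}(1+q^2)c$, $\langle v_{-2},v_2\rangle=q^{-2}c$. For modules on which the following makes sense, let $\sigma_{\mathcal R}=\tau\circ\mathcal R$, where $\tau$ is the flip and $\mathcal R=q^{H\otimes H/2}\sum_{m\ge0}\frac{q^{m(m-1)/2}(q-q^{-1})^m}{[m]_q!}E^m\otimes F^m$, with $K=q^H$ (so $q^{H\otimes H/2}$ is multiplication by $q^{2ab}$ on a tensor product of vectors on which $K$ acts by $q^{2a}$ and $q^{2b}$). On $V_{2\pi}\otimes V_{2\pi}\cong V_{4\pi}\oplus V_{2\pi}\oplus V_0$ the operator $\sigma_{\mathcal R}$ acts by $q^2$, $-q^{-2}$, $q^{-4}$ on the three summands. Let $D$ be the square root of $\sigma_{\mathcal R}^2=\mathcal R^{\mathrm{op}}\mathcal R$ acting by $q^2,q^{-2},q^{-4}$ on them, and let $\tilde\sigma=\sigma_{\mathcal R}D^{-1}$ be the normalized braiding, which thus acts by $1,-1,1$. Let $\mathrm{Cl}_q(\mathfrak{sl}_2)$ be the quotient of the tensor algebra $T(V_{2\pi})$ by the two-sided ideal generated by $x\otimes y+\tilde\sigma(x\otimes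 y)-2\langle x,y\rangle 1$, $x,y\in V_{2\pi}$; it is a $U_q(\mathfrak{sl}_2)$-module algebra by the unique extension of the action on $V_{2\pi}$. Let $\mathcal W_q(\mathfrak{sl}_2)=U_q(\mathfrak{sl}_2)\otimes_{\mathcal R}\mathrm{Cl}_q(\mathfrak{sl}_2)$ be the braided tensor product, i.e. the vector space $U_q(\mathfrak{sl}_2)\otimes\mathrm{Cl}_q(\mathfrak{sl}_2)$ with multiplication $(x\otimes v)(y\otimes w)=\sum_i xy_i\otimes v_iw$, where $\sigma_{\mathcal R}(v\otimes y)=\sum_i y_i\otimes v_i$ and $U_q(\mathfrak{sl}_2)$ carries the adjoint action. Put $$X=E,\qquad Z=q^{-2}EF-FE,\qquad Y=KF,\qquad C=EF+\frac{q^{-1}K+qK^{-1}}{(q-q^{-1})^2},$$ $$D_q=\frac1c\Bigl(X\otimes v_{-2}+\frac{q}{1+q^2}\,Z\otimes v_0+q^{-2}\,Y\otimes v_2\Bigr)-\frac{(q^2-1)^2}{2q(q^2+1)c^2}\,C\otimes(v_2v_0v_{-2}+c\,v_0).$$ Then in $\mathcal W_q(\mathfrak{sl}_2)$ $$D_q^2=\frac{(q^2+1)(q^2-1)^2}{4q^3c}\,C^2\otimes1-\frac{q(q^2+1)}{(q^2-1)^2c}\,1\otimes1,$$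 and $D_q^2$ is central in $\mathcal W_q(\mathfrak{sl}_2)$. -/

import Mathlib

open scoped TensorProduct

namespace QWeil

/-- The deformation parameter is nonzero and not a root of unity. -/
class IsGeneric {k : Type*} [Field k] (q : k) : Prop where
  ne_zero : q ≠ 0
  pow_ne_one : ∀ n : ℕ, 0 < n → q ^ n ≠ 1

section Generic
variable {k : Type*} [Field k] (q : k) [IsGeneric q]

lemma q_ne : q ≠ 0 := IsGeneric.ne_zero

lemma q_sq_sub_one_ne : q ^ 2 - 1 ≠ 0 := sub_ne_zero.2 (IsGeneric.pow_ne_one 2 (by norm_num))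

lemma q_sq_add_one_ne : q ^ 2 + 1 ≠ 0 := by
  intro h
  exact IsGeneric.pow_ne_one (q := q) 4 (by norm_num) (by linear_combination (q ^ 2 - 1) * h)

lemma q_fourth_add_one_ne : q ^ 4 + 1 ≠ 0 := by
  intro h
  exact IsGeneric.pow_ne_one (q := q) 8 (by norm_num) (by linear_combination (q ^ 4 - 1) * h)

lemma q_fourth_add_sq_add_one_ne : q ^ 4 + q ^ 2 + 1 ≠ 0 := by
  intro h
  exact IsGeneric.pow_ne_one (q := q) 6 (by norm_num) (by linear_combination (q ^ 2 - 1) * h)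

lemma q_sub_inv_ne : q - q⁻¹ ≠ 0 := by
  have h0 := q_ne q
  have h1 := q_sq_sub_one_ne q
  intro h
  apply h1
  field_simp at h
  linear_combination h

end Generic

/-! ### The quantum group `U_q(sl₂)` -/

/-- The generators `E`, `F`, `K`, `K⁻¹`. -/
inductive UGen
  | E | F | K | Kinv

section Uq
variable {k : Type*} [Field k]

open FreeAlgebra in
/-- The defining relations of `U_q(sl₂)`. -/
inductive URel (q : k) : FreeAlgebra k UGen → FreeAlgebra k UGen → Prop
  | KE : URel q (ι k .K * ι k .E) (q ^ 2 • (ι k .E * ι k .K))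
  | KF : URel q (ι k .K * ι k .F) ((q ^ 2)⁻¹ • (ι k .F * ι k .K))
  | KKinv : URel q (ι k .K * ι k .Kinv) 1
  | KinvK : URel q (ι k .Kinv * ι k .K) 1
  | EF : URel q (ι k .E * ι k .F - ι k .F * ι k .E) ((q - q⁻¹)⁻¹ • (ι k .K - ι k .Kinv))

/-- The Drinfeld–Jimbo quantum group `U_q(sl₂)` over `k`. -/
def Uq (q : k) : Type _ := RingQuot (URel q)

noncomputable instance (q : k) : Ring (Uq q) := inferInstanceAs (Ring (RingQuot (URel q)))
noncomputable instance (q : k) : Algebra k (Uq q) :=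
  inferInstanceAs (Algebra k (RingQuot (URel q)))

namespace Uq
variable (q : k)

/-- The quotient map from the free algebra. -/
noncomputable def mk : FreeAlgebra k UGen →ₐ[k] Uq q := RingQuot.mkAlgHom k (URel q)

noncomputable def E : Uq q := mk q (FreeAlgebra.ι k .E)
noncomputable def F : Uq q := mk q (FreeAlgebra.ι k .F)
noncomputable def K : Uq q := mk q (FreeAlgebra.ι k .K)
noncomputable def Kinv : Uq q := mk q (FreeAlgebra.ι k .Kinv)

lemma mk_rel {x y : FreeAlgebra k UGen} (h : URel q x y) : mk q x = mk q y :=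
  RingQuot.mkAlgHom_rel k h

lemma K_mul_E : K q * E q = q ^ 2 • (E q * K q) := by
  simpa only [map_mul, map_smul, E, F, K, Kinv] using mk_rel q URel.KE

lemma K_mul_F : K q * F q = (q ^ 2)⁻¹ • (F q * K q) := by
  simpa only [map_mul, map_smul, E, F, K, Kinv] using mk_rel q URel.KF

lemma K_mul_Kinv : K q * Kinv q = 1 := by
  simpa only [map_mul, map_one, K, Kinv] using mk_rel q URel.KKinv

lemma Kinv_mul_K : Kinv q * K q = 1 := by
  simpa only [map_mul, map_one, K, Kinv] using mk_rel q URel.KinvK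

lemma E_mul_F_sub : E q * F q - F q * E q = (q - q⁻¹)⁻¹ • (K q - Kinv q) := by
  simpa only [map_mul, map_sub, map_smul, E, F, K, Kinv] using mk_rel q URel.EF

/-- The element `K` as a unit, so that `K ^ n` makes sense for `n : ℤ`. -/
noncomputable def Kunit : (Uq q)ˣ := ⟨K q, Kinv q, K_mul_Kinv q, Kinv_mul_K q⟩

variable {q}

/-- The algebra map out of `U_q(sl₂)` determined by four elements satisfying the relations. -/
noncomputable def lift {A : Type*} [Ring A] [Algebra k A] (e f x y : A)
    (hKE : x * e = q ^ 2 • (e * x)) (hKF : x * f = (q ^ 2)⁻¹ • (f * x))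
    (hxy : x * y = 1) (hyx : y * x = 1)
    (hEF : e * f - f * e = (q - q⁻¹)⁻¹ • (x - y)) : Uq q →ₐ[k] A :=
  RingQuot.liftAlgHom k ⟨FreeAlgebra.lift k (fun g => UGen.casesOn g e f x y), by
    rintro _ _ (_ | _ | _ | _ | _) <;> simp [hKE, hKF, hxy, hyx, hEF]⟩

section lift
variable {A : Type*} [Ring A] [Algebra k A] (e f x y : A)
    (hKE : x * e = q ^ 2 • (e * x)) (hKF : x * f = (q ^ 2)⁻¹ • (f * x))
    (hxy : x * y = 1) (hyx : y * x = 1)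
    (hEF : e * f - f * e = (q - q⁻¹)⁻¹ • (x - y))

@[simp] lemma lift_E : lift e f x y hKE hKF hxy hyx hEF (E q) = e :=
  (RingQuot.liftAlgHom_mkAlgHom_apply k _ _ _).trans (by simp)
@[simp] lemma lift_F : lift e f x y hKE hKF hxy hyx hEF (F q) = f :=
  (RingQuot.liftAlgHom_mkAlgHom_apply k _ _ _).trans (by simp)
@[simp] lemma lift_K : lift e f x y hKE hKF hxy hyx hEF (K q) = x :=
  (RingQuot.liftAlgHom_mkAlgHom_apply k _ _ _).trans (by simp)
@[simp] lemma lift_Kinv : lift e f x y hKE hKF hxy hyx hEF (Kinv q) = y :=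
  (RingQuot.liftAlgHom_mkAlgHom_apply k _ _ _).trans (by simp)
end lift

@[elab_as_elim]
lemma induction {P : Uq q → Prop} (algebraMap : ∀ r : k, P (algebraMap k (Uq q) r))
    (E : P (E q)) (F : P (F q)) (K : P (K q)) (Kinv : P (Kinv q))
    (mul : ∀ a b, P a → P b → P (a * b)) (add : ∀ a b, P a → P b → P (a + b)) (u : Uq q) :
    P u := by
  obtain ⟨x, rfl⟩ := RingQuot.mkAlgHom_surjective k (URel q) u
  change P (mk q x)
  induction x using FreeAlgebra.induction with
  | grade0 r => simpa using algebraMap r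
  | grade1 g => cases g <;> assumption
  | mul a b ha hb => simpa using mul _ _ ha hb
  | add a b ha hb => simpa using add _ _ ha hb

lemma algHom_ext {A : Type*} [Ring A] [Algebra k A] {φ ψ : Uq q →ₐ[k] A}
    (hE : φ (E q) = ψ (E q)) (hF : φ (F q) = ψ (F q)) (hK : φ (K q) = ψ (K q))
    (hKinv : φ (Kinv q) = ψ (Kinv q)) : φ = ψ := by
  ext u
  induction u using induction with
  | algebraMap r => simp
  | E => exact hE
  | F => exact hF
  | K => exact hK
  | Kinv => exact hKinv
  | mul a b ha hb => simp [ha, hb]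
  | add a b ha hb => simp [ha, hb]

variable (q)

lemma E_mul_F : E q * F q = F q * E q + (q - q⁻¹)⁻¹ • (K q - Kinv q) := by
  rw [← E_mul_F_sub]; abel

section
variable [IsGeneric q]

lemma Kinv_mul_E : Kinv q * E q = (q ^ 2)⁻¹ • (E q * Kinv q) := by
  have h := congrArg (fun z => Kinv q * z * Kinv q) (K_mul_E q)
  have h0 := q_ne q
  simp only [mul_smul_comm, smul_mul_assoc, mul_assoc, K_mul_Kinv, mul_one] at h
  rw [← mul_assoc, Kinv_mul_K, one_mul] at h
  rw [h, smul_smul, inv_mul_cancel₀ (pow_ne_zero 2 h0), one_smul]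

lemma Kinv_mul_F : Kinv q * F q = q ^ 2 • (F q * Kinv q) := by
  have h := congrArg (fun z => Kinv q * z * Kinv q) (K_mul_F q)
  have h0 := q_ne q
  simp only [mul_smul_comm, smul_mul_assoc, mul_assoc, K_mul_Kinv, mul_one] at h
  rw [← mul_assoc, Kinv_mul_K, one_mul] at h
  rw [h, smul_smul, mul_inv_cancel₀ (pow_ne_zero 2 h0), one_smul]

/-- The coproduct. -/
noncomputable def comul : Uq q →ₐ[k] Uq q ⊗[k] Uq q :=
  lift (E q ⊗ₜ K q + 1 ⊗ₜ E q) (F q ⊗ₜ 1 + Kinv q ⊗ₜ F q) (K q ⊗ₜ K q) (Kinv q ⊗ₜ Kinv q)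
    (by
      simp only [mul_add, add_mul, Algebra.TensorProduct.tmul_mul_tmul, K_mul_E, one_mul, mul_one,
        TensorProduct.smul_tmul', TensorProduct.tmul_smul, smul_add])
    (by
      simp only [mul_add, add_mul, Algebra.TensorProduct.tmul_mul_tmul, K_mul_F, one_mul, mul_one,
        TensorProduct.smul_tmul', TensorProduct.tmul_smul, smul_add, K_mul_Kinv, Kinv_mul_K])
    (by simp [K_mul_Kinv, Algebra.TensorProduct.one_def])
    (by simp [Kinv_mul_K, Algebra.TensorProduct.one_def])
    (by
      have h0 := q_ne q
      simp only [mul_add, add_mul, Algebra.TensorProduct.tmul_mul_tmul, K_mul_F, one_mul, mul_one,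
        TensorProduct.smul_tmul', TensorProduct.tmul_smul, E_mul_F, Kinv_mul_E,
        TensorProduct.add_tmul, TensorProduct.tmul_add, TensorProduct.sub_tmul,
        TensorProduct.tmul_sub, smul_sub]
      match_scalars <;> (try field_simp) <;> ring)

/-- The counit. -/
noncomputable def counit : Uq q →ₐ[k] k :=
  lift 0 0 1 1 (by simp) (by simp) (by simp) (by simp) (by simp)

open MulOpposite in
/-- The antipode, as an algebra map to the opposite algebra. -/
noncomputable def antipode : Uq q →ₐ[k] (Uq q)ᵐᵒᵖ :=
  lift (op (-(E q * Kinv q))) (op (-(K q * F q))) (op (Kinv q)) (op (K q))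
    (by
      have h0 := q_ne q
      rw [← op_mul, ← op_mul, ← op_smul, mul_neg, ← mul_assoc, Kinv_mul_E, smul_mul_assoc, smul_neg,
        smul_smul, mul_inv_cancel₀ (pow_ne_zero 2 h0), one_smul, neg_mul])
    (by
      have h0 := q_ne q
      rw [← op_mul, ← op_mul, ← op_smul, mul_neg, ← mul_assoc, neg_mul, Kinv_mul_K, one_mul,
        K_mul_F, smul_mul_assoc, mul_assoc, K_mul_Kinv, mul_one, smul_neg])
    (by rw [← op_mul, K_mul_Kinv]; rfl)
    (by rw [← op_mul, Kinv_mul_K]; rfl)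
    (by
      have h0 := q_ne q
      rw [← op_mul, ← op_mul, ← op_sub, ← op_sub, ← op_smul]
      congr 1
      have h1 : K q * F q * (E q * Kinv q) = F q * E q := by
        rw [K_mul_F, smul_mul_assoc, mul_assoc, ← mul_assoc (K q), K_mul_E, smul_mul_assoc,
          mul_assoc, K_mul_Kinv, mul_one, mul_smul_comm, smul_smul,
          inv_mul_cancel₀ (pow_ne_zero 2 h0), one_smul]
      have h2 : E q * Kinv q * (K q * F q) = E q * F q := by
        rw [mul_assoc, ← mul_assoc (Kinv q), Kinv_mul_K, one_mul]
      rw [neg_mul_neg, neg_mul_neg, h1, h2, ← neg_sub, E_mul_F_sub, ← smul_neg, neg_sub])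

noncomputable instance : Bialgebra k (Uq q) :=
  Bialgebra.ofAlgHom (comul q) (counit q)
    (by apply algHom_ext <;>
      simp [comul, TensorProduct.add_tmul, TensorProduct.tmul_add, Algebra.TensorProduct.one_def,
        add_assoc])
    (by apply algHom_ext <;> simp [comul, counit])
    (by apply algHom_ext <;> simp [comul, counit])

end
end Uq
end Uq

section
variable {k : Type*} [Field k] (q : k) [IsGeneric q]

/-- The left adjoint action `ad a b = ∑ a₍₁₎ b S(a₍₂₎)`. -/
noncomputable def ad : Uq q →ₐ[k] Module.End k (Uq q) :=
  ((AlgHom.mulLeftRight k (Uq q)).comp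
    (Algebra.TensorProduct.map (AlgHom.id k (Uq q)) (Uq.antipode q))).comp (Uq.comul q)

lemma ad_E (b : Uq q) : ad q (Uq.E q) b = Uq.E q * b * Uq.Kinv q - b * (Uq.E q * Uq.Kinv q) := by
  simp [ad, Uq.comul, Uq.antipode, sub_eq_add_neg]

lemma ad_F (b : Uq q) :
    ad q (Uq.F q) b = Uq.F q * b - Uq.Kinv q * b * (Uq.K q * Uq.F q) := by
  simp [ad, Uq.comul, Uq.antipode, sub_eq_add_neg]

lemma ad_K (b : Uq q) : ad q (Uq.K q) b = Uq.K q * b * Uq.Kinv q := by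
  simp [ad, Uq.comul, Uq.antipode]

lemma ad_Kinv (b : Uq q) : ad q (Uq.Kinv q) b = Uq.Kinv q * b * Uq.K q := by
  simp [ad, Uq.comul, Uq.antipode]

open LaurentPolynomial in
/-- The grading of `U_q(sl₂)` by half-weights (`E ↦ 1`, `F ↦ -1`, `K ↦ 0`), as a coaction:
a homogeneous `y` of degree `b` is sent to `y T ^ b`. -/
noncomputable def gradingUq : Uq q →ₐ[k] LaurentPolynomial (Uq q) :=
  Uq.lift (C (Uq.E q) * T 1) (C (Uq.F q) * T (-1)) (C (Uq.K q)) (C (Uq.Kinv q))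
    (by
      rw [← mul_assoc, ← map_mul, Uq.K_mul_E, mul_assoc, T_mul, ← mul_assoc, ← map_mul]
      simp only [← single_eq_C, ← AddMonoidAlgebra.smul_single, smul_mul_assoc])
    (by
      rw [← mul_assoc, ← map_mul, Uq.K_mul_F, mul_assoc, T_mul, ← mul_assoc, ← map_mul]
      simp only [← single_eq_C, ← AddMonoidAlgebra.smul_single, smul_mul_assoc])
    (by rw [← map_mul, Uq.K_mul_Kinv, map_one])
    (by rw [← map_mul, Uq.Kinv_mul_K, map_one])
    (by
      have h (a b : Uq q) (m n : ℤ) : C a * T m * (C b * T n) = C (a * b) * T (m + n) := by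
        rw [mul_assoc, ← mul_assoc (T m), T_mul, map_mul, T_add]
        simp only [mul_assoc]
      rw [h, h, add_neg_cancel, neg_add_cancel, T_zero, mul_one, mul_one, ← map_sub,
        Uq.E_mul_F_sub, ← map_sub]
      simp only [← single_eq_C, AddMonoidAlgebra.smul_single])

/-- The decomposition of an element of `U_q(sl₂)` into its homogeneous components. Since
`K E = q² E K` and `K F = q⁻² F K`, `K` acts by `ad` on the component of degree `b` as `q^{2b}`. -/
noncomputable def weightUq : Uq q →ₗ[k] ℤ →₀ Uq q :=
  (AddMonoidAlgebra.coeffLinearEquiv k).toLinearMap ∘ₗ (gradingUq q).toLinearMap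

/-! ### The braiding given by the universal `R`-matrix -/

/-- `[m]_q = (q^m - q^{-m}) / (q - q⁻¹)`. -/
noncomputable def qInt (q : k) (m : ℕ) : k := (q ^ m - (q ^ m)⁻¹) / (q - q⁻¹)

/-- `[m]_q! = [m]_q ⋯ [1]_q`. -/
noncomputable def qFactorial (q : k) (m : ℕ) : k := ∏ j ∈ Finset.range m, qInt q (j + 1)

section Braiding
variable {M N : Type*} [AddCommGroup M] [Module k M] [AddCommGroup N] [Module k N]
  (ρM : Uq q →ₐ[k] Module.End k M) (ρN : Uq q →ₐ[k] Module.End k N)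
  (wN : N →ₗ[k] ℤ →₀ N)

/-- The action on `M ⊗ N` of the series
`∑ₘ q^{m(m-1)/2} (q - q⁻¹)^m / [m]_q! • E^m ⊗ F^m`. It is used only for `M = V_{2π}` and for
the finite-dimensional algebra `M = Cl_q(sl₂)`; there `E` raises weights, hence acts nilpotently,
and all but finitely many terms vanish. -/
noncomputable def braidR1 : Module.End k (M ⊗[k] N) :=
  ∑ᶠ m : ℕ, (q ^ m.choose 2 * (q - q⁻¹) ^ m / qFactorial q m) •
    TensorProduct.map (ρM (Uq.E q ^ m)) (ρN (Uq.F q ^ m))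

/-- The action of `q^{H ⊗ H / 2}` on `M ⊗ N`, where `wN` decomposes a vector of `N` into its
weight components, the component of index `b` being the one on which `K` acts by `q^{2b}`,
i.e. `H` by `2b`. On `v ⊗ y` with `H y = 2b y` the operator `q^{H ⊗ H / 2}` is
`q^{b H} v ⊗ y = K^b v ⊗ y`. -/
noncomputable def braidR0 : Module.End k (M ⊗[k] N) :=
  Finsupp.lsum k (fun b : ℤ => (ρM ((Uq.Kunit q ^ b : (Uq q)ˣ) : Uq q)).rTensor N) ∘ₗ
    (TensorProduct.finsuppRight k k M N ℤ).toLinearMap ∘ₗ wN.lTensor M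

/-- The braiding `σ_R = τ ∘ R : M ⊗ N → N ⊗ M` given by the universal `R`-matrix. -/
noncomputable def braid : M ⊗[k] N →ₗ[k] N ⊗[k] M :=
  (TensorProduct.comm k M N).toLinearMap ∘ₗ braidR0 q ρM wN ∘ₗ braidR1 q ρM ρN
end Braiding

/-! ### The module `V_{2π}` -/

/-- The underlying space of `V_{2π}`, with basis `v₂, v₀, v₋₂` (in this order). -/
abbrev Vad (k : Type*) := Fin 3 → k

/-- The module structure of `V_{2π}`:
`E v₀ = -(q+q⁻¹) v₂`, `E v₋₂ = v₀`, `F v₂ = -v₀`, `F v₀ = (q+q⁻¹) v₋₂`, `K v_i = q^i v_i`. -/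
noncomputable def rhoV : Uq q →ₐ[k] Module.End k (Vad k) :=
  (Matrix.toLinAlgEquiv' (R := k) (n := Fin 3)).toAlgHom.comp <|
    Uq.lift !![0, -(q + q⁻¹), 0; 0, 0, 1; 0, 0, 0] !![0, 0, 0; -1, 0, 0; 0, q + q⁻¹, 0]
      !![q ^ 2, 0, 0; 0, 1, 0; 0, 0, (q ^ 2)⁻¹] !![(q ^ 2)⁻¹, 0, 0; 0, 1, 0; 0, 0, q ^ 2]
      (by
        have h0 := q_ne q
        ext i j
        fin_cases i <;> fin_cases j <;> simp
        field_simp)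
      (by
        have h0 := q_ne q
        ext i j
        fin_cases i <;> fin_cases j <;> simp [h0])
      (by
        have h0 := q_ne q
        ext i j
        fin_cases i <;> fin_cases j <;> simp [h0])
      (by
        have h0 := q_ne q
        ext i j
        fin_cases i <;> fin_cases j <;> simp [h0])
      (by
        have h0 := q_ne q
        have h1 := q_sub_inv_ne q
        have h5 : (q - q⁻¹)⁻¹ * (q ^ 2 - (q ^ 2)⁻¹) = q + q⁻¹ := by
          rw [inv_mul_eq_iff_eq_mul₀ h1]
          field_simp
          ring
        have h6 : (q - q⁻¹)⁻¹ * ((q ^ 2)⁻¹ - q ^ 2) = -(q + q⁻¹) := by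
          rw [← h5]
          ring
        ext i j
        fin_cases i <;> fin_cases j <;> simp [h5, h6])

/-- The half-weights of `v₂, v₀, v₋₂`. -/
def wtV : Fin 3 → ℤ := ![1, 0, -1]

variable (k) in
/-- The decomposition of a vector of `V_{2π}` into its weight components. -/
noncomputable def weightV : Vad k →ₗ[k] ℤ →₀ Vad k :=
  ∑ i, Finsupp.lsingle (wtV i) ∘ₗ LinearMap.single k (fun _ => k) i ∘ₗ LinearMap.proj i

/-- The invariant form: `⟨v₂, v₋₂⟩ = c`, `⟨v₀, v₀⟩ = q⁻³(1+q²)c`, `⟨v₋₂, v₂⟩ = c q⁻²`, all other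
values on basis vectors being zero. -/
noncomputable def formV (c : k) : LinearMap.BilinForm k (Vad k) :=
  Matrix.toBilin' !![0, 0, c; 0, (q ^ 3)⁻¹ * (1 + q ^ 2) * c, 0; c * (q ^ 2)⁻¹, 0, 0]

/-- The `R`-matrix braiding on `V_{2π} ⊗ V_{2π}`. -/
noncomputable def sigmaV : Module.End k (Vad k ⊗[k] Vad k) := braid q (rhoV q) (rhoV q) (weightV k)

lemma finsum_eq_range {B : Type*} [AddCommMonoid B] (n : ℕ) (f : ℕ → B) (h : ∀ m, n ≤ m → f m = 0) :
    ∑ᶠ m, f m = ∑ m ∈ Finset.range n, f m := by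
  apply finsum_eq_sum_of_support_subset
  intro m hm
  simp only [Finset.coe_range, Set.mem_Iio]
  by_contra h'
  exact hm (h m (not_lt.1 h'))

/-- The basis vectors: `vb k 0 = v₂`, `vb k 1 = v₀`, `vb k 2 = v₋₂`. -/
def vb (k : Type*) [Field k] (i : Fin 3) : Vad k := Pi.single i 1

lemma rhoV_E (i : Fin 3) : rhoV q (Uq.E q) (vb k i) =
    ![0, -(q + q⁻¹) • vb k 0, vb k 1] i := by
  fin_cases i <;> ext j <;> fin_cases j <;> simp [rhoV, vb]

lemma rhoV_F (i : Fin 3) : rhoV q (Uq.F q) (vb k i) =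
    ![-vb k 1, (q + q⁻¹) • vb k 2, 0] i := by
  fin_cases i <;> ext j <;> fin_cases j <;> simp [rhoV, vb]

lemma rhoV_K (i : Fin 3) : rhoV q (Uq.K q) (vb k i) =
    ![q ^ 2 • vb k 0, vb k 1, (q ^ 2)⁻¹ • vb k 2] i := by
  fin_cases i <;> ext j <;> fin_cases j <;> simp [rhoV, vb]

lemma rhoV_Kinv (i : Fin 3) : rhoV q (Uq.Kinv q) (vb k i) =
    ![(q ^ 2)⁻¹ • vb k 0, vb k 1, q ^ 2 • vb k 2] i := by
  fin_cases i <;> ext j <;> fin_cases j <;> simp [rhoV, vb]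

lemma tensor_ext {P : Type*} [AddCommGroup P] [Module k P] {f g : Vad k ⊗[k] Vad k →ₗ[k] P}
    (h : ∀ i j, f (vb k i ⊗ₜ vb k j) = g (vb k i ⊗ₜ vb k j)) : f = g := by
  apply TensorProduct.ext
  apply LinearMap.pi_ext'
  intro i
  ext j
  simpa [vb] using h i j

lemma rhoV_E_pow (m : ℕ) (hm : 3 ≤ m) : rhoV q (Uq.E q ^ m) = 0 := by
  rw [← Nat.sub_add_cancel hm, pow_add, map_mul]
  have : rhoV q (Uq.E q ^ 3) = 0 := by
    rw [map_pow]
    apply LinearMap.pi_ext'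
    intro i
    ext1
    change ((rhoV q (Uq.E q)) ^ 3) (vb k i) = 0
    fin_cases i <;> simp [pow_succ, rhoV_E]
  rw [this, mul_zero]

lemma braidR1_V : braidR1 q (rhoV q) (rhoV q) = ∑ m ∈ Finset.range 3,
    (q ^ m.choose 2 * (q - q⁻¹) ^ m / qFactorial q m) •
    TensorProduct.map (rhoV q (Uq.E q ^ m)) (rhoV q (Uq.F q ^ m)) := by
  apply finsum_eq_range
  intro m hm
  rw [rhoV_E_pow q m hm, TensorProduct.map_zero_left, smul_zero]

lemma weightV_vb (i : Fin 3) : weightV k (vb k i) = Finsupp.single (wtV i) (vb k i) := by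
  fin_cases i <;> simp [weightV, vb, Fin.sum_univ_three]

lemma braidR0_V (x : Vad k) (i : Fin 3) :
    braidR0 q (rhoV q) (weightV k) (x ⊗ₜ vb k i) =
      ![rhoV q (Uq.K q) x, x, rhoV q (Uq.Kinv q) x] i ⊗ₜ vb k i := by
  fin_cases i <;> simp [braidR0, weightV_vb, wtV, Uq.Kunit]

lemma sigmaV_vb (i j : Fin 3) : sigmaV q (vb k i ⊗ₜ vb k j) =
    ![![q ^ 2 • (vb k 0 ⊗ₜ[k] vb k 0), vb k 1 ⊗ₜ[k] vb k 0, (q ^ 2)⁻¹ • (vb k 2 ⊗ₜ[k] vb k 0)],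
      ![vb k 0 ⊗ₜ[k] vb k 1 + (q ^ 2 - (q ^ 2)⁻¹) • (vb k 1 ⊗ₜ[k] vb k 0),
        vb k 1 ⊗ₜ[k] vb k 1 - ((q ^ 2 - 1) * (q ^ 2 + 1) ^ 2 / q ^ 5) • (vb k 2 ⊗ₜ[k] vb k 0),
        vb k 2 ⊗ₜ[k] vb k 1],
      ![(q ^ 2)⁻¹ • (vb k 0 ⊗ₜ[k] vb k 2) + ((1 - q ^ 2) / q) • (vb k 1 ⊗ₜ[k] vb k 1) +
          ((q ^ 2 - 1) ^ 2 * (q ^ 2 + 1) / q ^ 4) • (vb k 2 ⊗ₜ[k] vb k 0),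
        vb k 1 ⊗ₜ[k] vb k 2 + (q ^ 2 - (q ^ 2)⁻¹) • (vb k 2 ⊗ₜ[k] vb k 1),
        q ^ 2 • (vb k 2 ⊗ₜ[k] vb k 2)]] i j := by
  have h0 := q_ne q
  have h1 := q_sub_inv_ne q
  have h2 := q_sq_add_one_ne q
  have h3 := q_sq_sub_one_ne q
  have hf1 : qFactorial q 1 = 1 := by simp [qFactorial, qInt, h1]
  have hf2 : qFactorial q 2 = q + q⁻¹ := by
    have h5 : qInt q 2 = q + q⁻¹ := by
      rw [qInt, div_eq_iff h1]
      field_simp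
      ring
    have h6 : qInt q 1 = 1 := by simp [qInt, h1]
    simp [qFactorial, Finset.prod_range_succ, h6, h5]
  have hf0 : qFactorial q 0 = 1 := by simp [qFactorial]
  rw [sigmaV, braid, LinearMap.comp_apply, LinearMap.comp_apply, braidR1_V]
  fin_cases i <;> fin_cases j <;>
    simp [Finset.sum_range_succ, hf0, hf1, hf2, pow_succ, rhoV_E, rhoV_F, rhoV_K, rhoV_Kinv,
      braidR0_V, ← TensorProduct.smul_tmul', TensorProduct.tmul_smul, TensorProduct.neg_tmul,
      TensorProduct.tmul_neg, -neg_add_rev]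
  all_goals (match_scalars <;> (try field_simp) <;> (try ring))

end

section
variable {k : Type*} [Field k] (q : k) [IsGeneric q]

/-- The diagonal action of `U_q(sl₂)` on `V ⊗ V`. -/
noncomputable def rhoVV : Uq q →ₐ[k] Module.End k (Vad k ⊗[k] Vad k) :=
  (Module.endTensorEndAlgHom.comp (Algebra.TensorProduct.map (rhoV q) (rhoV q))).comp (Uq.comul q)

lemma rhoVV_E (x y : Vad k) : rhoVV q (Uq.E q) (x ⊗ₜ y) =
    rhoV q (Uq.E q) x ⊗ₜ rhoV q (Uq.K q) y + x ⊗ₜ rhoV q (Uq.E q) y := by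
  simp [rhoVV, Uq.comul, Module.endTensorEndAlgHom_apply]

lemma rhoVV_F (x y : Vad k) : rhoVV q (Uq.F q) (x ⊗ₜ y) =
    rhoV q (Uq.F q) x ⊗ₜ y + rhoV q (Uq.Kinv q) x ⊗ₜ rhoV q (Uq.F q) y := by
  simp [rhoVV, Uq.comul, Module.endTensorEndAlgHom_apply]

lemma rhoVV_K (x y : Vad k) : rhoVV q (Uq.K q) (x ⊗ₜ y) =
    rhoV q (Uq.K q) x ⊗ₜ rhoV q (Uq.K q) y := by
  simp [rhoVV, Uq.comul, Module.endTensorEndAlgHom_apply]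

lemma rhoVV_Kinv (x y : Vad k) : rhoVV q (Uq.Kinv q) (x ⊗ₜ y) =
    rhoV q (Uq.Kinv q) x ⊗ₜ rhoV q (Uq.Kinv q) y := by
  simp [rhoVV, Uq.comul, Module.endTensorEndAlgHom_apply]

lemma sigmaV_commute (u : Uq q) : Commute (sigmaV q) (rhoVV q u) := by
  have h0 := q_ne q
  induction u using Uq.induction with
  | algebraMap r => rw [AlgHom.commutes]; exact (Algebra.commutes r _).symm
  | mul a b ha hb => rw [map_mul]; exact ha.mul_right hb
  | add a b ha hb => rw [map_add]; exact ha.add_right hb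
  | E =>
    apply tensor_ext
    intro i j
    fin_cases i <;> fin_cases j <;>
      simp [rhoVV_E, sigmaV_vb, rhoV_E, rhoV_K, ← TensorProduct.smul_tmul',
        TensorProduct.tmul_smul, TensorProduct.neg_tmul, TensorProduct.tmul_neg, -neg_add_rev]
    all_goals (match_scalars <;> (try field_simp) <;> (try ring))
  | F =>
    apply tensor_ext
    intro i j
    fin_cases i <;> fin_cases j <;>
      simp [rhoVV_F, sigmaV_vb, rhoV_F, rhoV_Kinv, ← TensorProduct.smul_tmul',
        TensorProduct.tmul_smul, TensorProduct.neg_tmul, TensorProduct.tmul_neg, -neg_add_rev]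
    all_goals (match_scalars <;> (try field_simp) <;> (try ring))
  | K =>
    apply tensor_ext
    intro i j
    fin_cases i <;> fin_cases j <;>
      simp [rhoVV_K, sigmaV_vb, rhoV_K, ← TensorProduct.smul_tmul', TensorProduct.tmul_smul]
    all_goals (match_scalars <;> (try field_simp) <;> (try ring))
  | Kinv =>
    apply tensor_ext
    intro i j
    fin_cases i <;> fin_cases j <;>
      simp [rhoVV_Kinv, sigmaV_vb, rhoV_Kinv, ← TensorProduct.smul_tmul', TensorProduct.tmul_smul]
    all_goals (match_scalars <;> (try field_simp) <;> (try ring))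

lemma formV_vb (c : k) (i j : Fin 3) : formV q c (vb k i) (vb k j) =
    ![![0, 0, c], ![0, (q ^ 3)⁻¹ * (1 + q ^ 2) * c, 0], ![c * (q ^ 2)⁻¹, 0, 0]] i j := by
  fin_cases i <;> fin_cases j <;> simp [formV, vb]

/-- Invariance of the form. -/
lemma formV_invariant (c : k) (u : Uq q) :
    TensorProduct.lift (formV q c) ∘ₗ rhoVV q u =
      Uq.counit q u • TensorProduct.lift (formV q c) := by
  have h0 := q_ne q
  induction u using Uq.induction with
  | algebraMap r =>
    rw [AlgHom.commutes, AlgHom.commutes, Module.algebraMap_end_eq_smul_id]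
    ext; simp
  | mul a b ha hb =>
    rw [map_mul, map_mul, Module.End.mul_eq_comp, ← LinearMap.comp_assoc, ha, LinearMap.smul_comp,
      hb, smul_smul]
  | add a b ha hb => rw [map_add, map_add, LinearMap.comp_add, ha, hb, add_smul]
  | E =>
    apply tensor_ext
    intro i j
    fin_cases i <;> fin_cases j <;>
      simp [rhoVV_E, formV_vb, rhoV_E, rhoV_K, Uq.counit] <;> field_simp <;> ring
  | F =>
    apply tensor_ext
    intro i j
    fin_cases i <;> fin_cases j <;>
      simp [rhoVV_F, formV_vb, rhoV_F, rhoV_Kinv, Uq.counit] <;> field_simp <;> ring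
  | K =>
    apply tensor_ext
    intro i j
    fin_cases i <;> fin_cases j <;>
      simp [rhoVV_K, formV_vb, rhoV_K, Uq.counit] <;> field_simp
  | Kinv =>
    apply tensor_ext
    intro i j
    fin_cases i <;> fin_cases j <;>
      simp [rhoVV_Kinv, formV_vb, rhoV_Kinv, Uq.counit] <;> field_simp

lemma sigmaV_minpoly : (sigmaV q - algebraMap k _ (q ^ 2)) * (sigmaV q - algebraMap k _ (-(q ^ 2)⁻¹)) *
    (sigmaV q - algebraMap k _ (q ^ 4)⁻¹) = 0 := by
  have h0 := q_ne q
  apply tensor_ext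
  intro i j
  fin_cases i <;> fin_cases j <;>
    simp [Module.algebraMap_end_eq_smul_id, sigmaV_vb] 
  all_goals (match_scalars <;> (try field_simp) <;> (try ring))
 
end

section
variable {k : Type*} [Field k] (q : k) [IsGeneric q]

/-! ### The normalised braiding -/

/-- The eigenvalues of `σ_R` on the summands `V_{4π}`, `V_{2π}`, `V_0` of `V_{2π} ⊗ V_{2π}`. -/
def sigmaVEigenvalue : Fin 3 → k := ![q ^ 2, -(q ^ 2)⁻¹, (q ^ 4)⁻¹]

lemma sigmaVEigenvalue_injective : Function.Injective (sigmaVEigenvalue q) := by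
  have h0 := q_ne q
  have h1 := q_fourth_add_one_ne q
  have h2 : q ^ 6 ≠ 1 := IsGeneric.pow_ne_one 6 (by norm_num)
  have h3 := q_sq_add_one_ne q
  have a01 : q ^ 2 ≠ -(q ^ 2)⁻¹ := fun h => h1 (by
    field_simp at h
    linear_combination h)
  have a02 : q ^ 2 ≠ (q ^ 4)⁻¹ := fun h => h2 (by
    field_simp at h
    linear_combination h)
  have a12 : -(q ^ 2)⁻¹ ≠ (q ^ 4)⁻¹ := fun h => h3 (by
    field_simp at h
    linear_combination -h)
  intro i j h
  fin_cases i <;> fin_cases j <;> simp [sigmaVEigenvalue] at h ⊢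
  · exact a01 h
  · exact a02 h
  · exact a01 h.symm
  · exact a12 h
  · exact a02 h.symm
  · exact a12 h.symm

open Polynomial in
lemma aeval_sigmaV_eq {f g : k[X]}
    (h : ∀ i, f.eval (sigmaVEigenvalue q i) = g.eval (sigmaVEigenvalue q i)) :
    aeval (sigmaV q) f = aeval (sigmaV q) g := by
  have hd : ∏ i, (X - C (sigmaVEigenvalue q i)) ∣ f - g :=
    Fintype.prod_dvd_of_coprime (pairwise_coprime_X_sub_C (sigmaVEigenvalue_injective q))
      (fun i => dvd_iff_isRoot.2 (by simp [h i]))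
  have h0 : aeval (sigmaV q) (∏ i, (X - C (sigmaVEigenvalue q i))) = 0 := by
    rw [Fin.prod_univ_three]
    simpa [sigmaVEigenvalue] using sigmaV_minpoly q
  obtain ⟨r, hr⟩ := hd
  have h1 : aeval (sigmaV q) (f - g) = 0 := by rw [hr, map_mul, h0, zero_mul]
  exact sub_eq_zero.1 ((map_sub _ f g).symm.trans h1)

/-- The operator acting by the scalar `r i` on the eigenspace of `σ_R` for its `i`-th eigenvalue,
i.e. on `V_{4π}`, `V_{2π}`, `V_0` for `i = 0, 1, 2` (a polynomial in `σ_R`). -/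
noncomputable def spectral (r : Fin 3 → k) : Module.End k (Vad k ⊗[k] Vad k) :=
  Polynomial.aeval (sigmaV q) (Lagrange.interpolate Finset.univ (sigmaVEigenvalue q) r)

lemma spectral_mul (r s : Fin 3 → k) : spectral q r * spectral q s = spectral q (r * s) := by
  rw [spectral, spectral, spectral, ← map_mul]
  apply aeval_sigmaV_eq
  intro i
  have hi := (sigmaVEigenvalue_injective q).injOn (s := ((Finset.univ : Finset (Fin 3)) : Set _))
  rw [Polynomial.eval_mul]
  simp only [Lagrange.eval_interpolate_at_node _ hi (Finset.mem_univ i), Pi.mul_apply]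

lemma spectral_one : spectral q 1 = 1 := by
  rw [spectral, ← map_one (Polynomial.aeval (R := k) (sigmaV q))]
  apply aeval_sigmaV_eq
  intro i
  have hi := (sigmaVEigenvalue_injective q).injOn (s := ((Finset.univ : Finset (Fin 3)) : Set _))
  simp only [Lagrange.eval_interpolate_at_node _ hi (Finset.mem_univ i), Polynomial.eval_one,
    Pi.one_apply]

lemma spectral_eigenvalue : spectral q (sigmaVEigenvalue q) = sigmaV q := by
  conv_rhs => rw [← Polynomial.aeval_X (R := k) (sigmaV q)]
  apply aeval_sigmaV_eq
  intro i
  have hi := (sigmaVEigenvalue_injective q).injOn (s := ((Finset.univ : Finset (Fin 3)) : Set _))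
  simp only [Lagrange.eval_interpolate_at_node _ hi (Finset.mem_univ i), Polynomial.eval_X]

lemma spectral_commute (r : Fin 3 → k) (u : Uq q) : Commute (spectral q r) (rhoVV q u) := by
  rw [spectral, Polynomial.aeval_eq_sum_range]
  refine Commute.sum_left _ _ _ fun i _ => ?_
  exact ((sigmaV_commute q u).pow_left i).smul_left _

/-- Drinfeld's operator `D` on `V_{2π} ⊗ V_{2π}`: the square root of `R^op R = σ_R ∘ σ_R` which
specialises to the identity at `q = 1`; it is `q²`, `q⁻²`, `q⁻⁴` on `V_{4π}`, `V_{2π}`, `V_0`. -/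
noncomputable def drinfeldD : Module.End k (Vad k ⊗[k] Vad k) :=
  spectral q ![q ^ 2, (q ^ 2)⁻¹, (q ^ 4)⁻¹]

lemma drinfeldD_sq : drinfeldD q * drinfeldD q = sigmaV q * sigmaV q := by
  rw [← spectral_eigenvalue q, drinfeldD, spectral_mul, spectral_mul]
  congr 1
  ext i
  fin_cases i <;> simp [sigmaVEigenvalue]

/-- The normalised braiding `σ̃ = τ ∘ R ∘ D⁻¹ = σ_R ∘ D⁻¹` on `V_{2π} ⊗ V_{2π}`. -/
noncomputable def normBraid : Module.End k (Vad k ⊗[k] Vad k) :=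
  sigmaV q * Ring.inverse (drinfeldD q)

/-- `σ̃` is `1`, `-1`, `1` on `V_{4π}`, `V_{2π}`, `V_0`. -/
lemma normBraid_eq : normBraid q = spectral q ![1, -1, 1] := by
  have h0 := q_ne q
  have h1 : drinfeldD q * spectral q ![(q ^ 2)⁻¹, q ^ 2, q ^ 4] = 1 := by
    rw [drinfeldD, spectral_mul, ← spectral_one q]
    congr 1
    ext i
    fin_cases i <;> simp [h0]
  have h2 : spectral q ![(q ^ 2)⁻¹, q ^ 2, q ^ 4] * drinfeldD q = 1 := by
    rw [drinfeldD, spectral_mul, ← spectral_one q]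
    congr 1
    ext i
    fin_cases i <;> simp [h0]
  have h3 : Ring.inverse (drinfeldD q) = spectral q ![(q ^ 2)⁻¹, q ^ 2, q ^ 4] :=
    Ring.inverse_unit ⟨_, _, h1, h2⟩
  rw [normBraid, h3, ← spectral_eigenvalue q, spectral_mul]
  congr 1
  ext i
  fin_cases i <;> simp [h0, sigmaVEigenvalue]

lemma normBraid_commute (u : Uq q) : Commute (normBraid q) (rhoVV q u) := by
  rw [normBraid_eq]; exact spectral_commute q _ u

/-! ### The `q`-deformed Clifford algebra -/

variable (c : k)

open TensorAlgebra in
/-- The relations `x ⊗ y + σ̃(x ⊗ y) = 2 ⟨x, y⟩ 1` in the tensor algebra of `V_{2π}`. -/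
inductive CliffRel : TensorAlgebra k (Vad k) → TensorAlgebra k (Vad k) → Prop
  | mk (x y : Vad k) : CliffRel
      (ι k x * ι k y + LinearMap.mul' k _ (TensorProduct.map (ι k) (ι k) (normBraid q (x ⊗ₜ y))))
      (algebraMap k _ (2 * formV q c x y))

/-- The `q`-deformed Clifford algebra `Cl_q(sl₂)`. -/
def Clq : Type _ := RingQuot (CliffRel q c)

noncomputable instance : Ring (Clq q c) := inferInstanceAs (Ring (RingQuot (CliffRel q c)))
noncomputable instance : Algebra k (Clq q c) :=
  inferInstanceAs (Algebra k (RingQuot (CliffRel q c)))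

namespace Clq

/-- The quotient map from the tensor algebra. -/
noncomputable def mk : TensorAlgebra k (Vad k) →ₐ[k] Clq q c := RingQuot.mkAlgHom k (CliffRel q c)

/-- The canonical map `V_{2π} → Cl_q(sl₂)`. -/
noncomputable def ι : Vad k →ₗ[k] Clq q c := (mk q c).toLinearMap ∘ₗ TensorAlgebra.ι k

/-- The map `V_{2π} ⊗ V_{2π} → Cl_q(sl₂)`, `x ⊗ y ↦ x y`. -/
noncomputable def ιι : Vad k ⊗[k] Vad k →ₗ[k] Clq q c :=
  LinearMap.mul' k (Clq q c) ∘ₗ TensorProduct.map (ι q c) (ι q c)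

lemma ιι_add (t : Vad k ⊗[k] Vad k) :
    ιι q c t + ιι q c (normBraid q t) =
      algebraMap k _ (2 * TensorProduct.lift (formV q c) t) := by
  have hm (t : Vad k ⊗[k] Vad k) : mk q c (LinearMap.mul' k _ (TensorProduct.map
      (TensorAlgebra.ι k) (TensorAlgebra.ι k) t)) = ιι q c t := by
    induction t with
    | zero => simp
    | add a b ha hb => simp [ha, hb]
    | tmul a b => simp [ιι, ι]
  induction t with
  | zero => simp
  | add a b ha hb =>
    rw [map_add, map_add, map_add, map_add, mul_add, map_add, ← ha, ← hb]
    abel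
  | tmul x y =>
    have h : mk q c _ = mk q c _ := RingQuot.mkAlgHom_rel k (CliffRel.mk (q := q) (c := c) x y)
    rw [map_add, hm, AlgHom.commutes, map_mul] at h
    rw [TensorProduct.lift.tmul, ← h]
    simp [ιι, ι]

variable {q c}

/-- The universal property of `Cl_q(sl₂)`. -/
noncomputable def lift {A : Type*} [Ring A] [Algebra k A] (f : Vad k →ₗ[k] A)
    (hf : ∀ x y, f x * f y + LinearMap.mul' k A (TensorProduct.map f f (normBraid q (x ⊗ₜ y))) =
      algebraMap k A (2 * formV q c x y)) : Clq q c →ₐ[k] A :=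
  RingQuot.liftAlgHom k ⟨TensorAlgebra.lift k f, by
    have hm (t : Vad k ⊗[k] Vad k) : TensorAlgebra.lift k f (LinearMap.mul' k _ (TensorProduct.map
        (TensorAlgebra.ι k) (TensorAlgebra.ι k) t)) =
          LinearMap.mul' k A (TensorProduct.map f f t) := by
      induction t with
      | zero => simp
      | add a b ha hb => simp [ha, hb]
      | tmul a b => simp
    rintro _ _ ⟨x, y⟩
    rw [map_add, hm, AlgHom.commutes, ← hf]
    simp⟩

@[simp] lemma lift_ι {A : Type*} [Ring A] [Algebra k A] (f : Vad k →ₗ[k] A)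
    (hf : ∀ x y, f x * f y + LinearMap.mul' k A (TensorProduct.map f f (normBraid q (x ⊗ₜ y))) =
      algebraMap k A (2 * formV q c x y)) (x : Vad k) : lift f hf (ι q c x) = f x :=
  (RingQuot.liftAlgHom_mkAlgHom_apply k _ _ _).trans (by simp)

@[elab_as_elim]
lemma induction {P : Clq q c → Prop} (algebraMap : ∀ r : k, P (algebraMap k (Clq q c) r))
    (ι : ∀ x, P (ι q c x)) (mul : ∀ a b, P a → P b → P (a * b))
    (add : ∀ a b, P a → P b → P (a + b)) (a : Clq q c) : P a := by
  obtain ⟨x, rfl⟩ := RingQuot.mkAlgHom_surjective k (CliffRel q c) a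
  change P (mk q c x)
  induction x using TensorAlgebra.induction with
  | algebraMap r => simpa using algebraMap r
  | ι x => exact ι x
  | mul a b ha hb => simpa using mul _ _ ha hb
  | add a b ha hb => simpa using add _ _ ha hb

end Clq

open WithConv in
/-- The action of `U_q(sl₂)` on `Cl_q(sl₂)` as `a ↦ (u ↦ u ▷ a)`. This is the algebra map into the
convolution algebra `Hom(U_q(sl₂), Cl_q(sl₂))` extending the action on `V_{2π}`, so that
`u ▷ (a b) = ∑ (u₍₁₎ ▷ a) (u₍₂₎ ▷ b)` and `u ▷ 1 = ε(u)`. -/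
noncomputable def clActConv : Clq q c →ₐ[k] WithConv (Uq q →ₗ[k] Clq q c) :=
  Clq.lift ((WithConv.linearEquiv k (Uq q →ₗ[k] Clq q c)).symm.toLinearMap ∘ₗ
    (rhoV q).toLinearMap.flip.compr₂ (Clq.ι q c)) (by
    set f := ((WithConv.linearEquiv k (Uq q →ₗ[k] Clq q c)).symm.toLinearMap ∘ₗ
      (rhoV q).toLinearMap.flip.compr₂ (Clq.ι q c)) with hf
    have hm (t : Vad k ⊗[k] Vad k) (u : Uq q) :
        (LinearMap.mul' k _ (TensorProduct.map f f t)) u = Clq.ιι q c (rhoVV q u t) := by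
      induction t with
      | zero => simp
      | add a b ha hb => simp only [map_add, ofConv_add, LinearMap.add_apply, ha, hb]
      | tmul x y =>
        rw [TensorProduct.map_tmul, LinearMap.mul'_apply, LinearMap.convMul_apply]
        change LinearMap.mul' k _ (TensorProduct.map _ _ (Uq.comul q u)) =
          Clq.ιι q c (Module.endTensorEndAlgHom
            (Algebra.TensorProduct.map (rhoV q) (rhoV q) (Uq.comul q u)) (x ⊗ₜ y))
        induction Uq.comul q u with
        | zero => simp
        | add a b ha hb => simp only [map_add, ha, hb, LinearMap.add_apply]
        | tmul a b => simp [Module.endTensorEndAlgHom_apply, Clq.ιι, hf]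
    intro x y
    ext u
    rw [ofConv_add, LinearMap.add_apply, hm, LinearMap.convAlgebraMap_apply]
    have h1 := hm (x ⊗ₜ y) u
    rw [TensorProduct.map_tmul, LinearMap.mul'_apply] at h1
    rw [h1]
    have h2 := congrArg (fun g => g (x ⊗ₜ[k] y)) (normBraid_commute q u).eq
    simp only [Module.End.mul_apply] at h2
    rw [← h2, Clq.ιι_add]
    have h3 := congrArg (fun g => g (x ⊗ₜ[k] y)) (formV_invariant q c u)
    simp only [LinearMap.comp_apply, LinearMap.smul_apply, TensorProduct.lift.tmul] at h3
    rw [h3]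
    change _ = (2 * formV q c x y) • algebraMap k _ (Uq.counit q u)
    rw [smul_eq_mul, Algebra.smul_def, ← map_mul]
    congr 1
    ring)

lemma clActConv_ι (x : Vad k) (u : Uq q) :
    clActConv q c (Clq.ι q c x) u = Clq.ι q c (rhoV q u x) := by
  simp [clActConv]

lemma clActConv_mul (a b : Clq q c) (u : Uq q) :
    clActConv q c (a * b) u = LinearMap.mul' k _ (TensorProduct.map
      (clActConv q c a).ofConv (clActConv q c b).ofConv (Uq.comul q u)) := by
  rw [map_mul]; rfl

lemma clActConv_algebraMap (r : k) (u : Uq q) :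
    clActConv q c (algebraMap k _ r) u = (r * Uq.counit q u) • 1 := by
  rw [AlgHom.commutes, LinearMap.convAlgebraMap_apply, Algebra.algebraMap_eq_smul_one, smul_smul]
  rfl

lemma clActConv_one (a : Clq q c) : clActConv q c a 1 = a := by
  induction a using Clq.induction with
  | algebraMap r => rw [clActConv_algebraMap, map_one, mul_one, Algebra.algebraMap_eq_smul_one]
  | ι x => rw [clActConv_ι, map_one, Module.End.one_apply]
  | mul a b ha hb =>
    rw [clActConv_mul, map_one, Algebra.TensorProduct.one_def, TensorProduct.map_tmul, ha, hb,
      LinearMap.mul'_apply]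
  | add a b ha hb => rw [map_add, WithConv.ofConv_add, LinearMap.add_apply, ha, hb]

lemma clActConv_smul (a : Clq q c) (u u' : Uq q) :
    clActConv q c a (u * u') = clActConv q c (clActConv q c a u') u := by
  induction a using Clq.induction generalizing u u' with
  | algebraMap r =>
    rw [clActConv_algebraMap, clActConv_algebraMap, 
      ← Algebra.algebraMap_eq_smul_one (r * Uq.counit q u'), clActConv_algebraMap, map_mul]
    congr 1
    ring
  | ι x => rw [clActConv_ι, clActConv_ι, clActConv_ι, map_mul, Module.End.mul_apply]
  | add a b ha hb =>
    simp only [map_add, WithConv.ofConv_add, LinearMap.add_apply, ha, hb]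
  | mul a b ha hb =>
    rw [clActConv_mul, clActConv_mul, map_mul]
    induction Uq.comul q u' with
    | zero => simp
    | add s t hs ht =>
      simp only [mul_add, map_add, hs, ht, WithConv.ofConv_add, LinearMap.add_apply]
    | tmul s t =>
      rw [TensorProduct.map_tmul, LinearMap.mul'_apply, clActConv_mul]
      induction Uq.comul q u with
      | zero => simp
      | add x y hx hy => simp only [add_mul, map_add, hx, hy]
      | tmul x y => simp [ha, hb]

/-- The `U_q(sl₂)`-module structure of `Cl_q(sl₂)`. -/
noncomputable def clAct : Uq q →ₐ[k] Module.End k (Clq q c) :=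
  AlgHom.ofLinearMap
    (((WithConv.linearEquiv k (Uq q →ₗ[k] Clq q c)).toLinearMap ∘ₗ
      (clActConv q c).toLinearMap).flip)
    (by ext a; exact clActConv_one q c a)
    (by intro u u'; ext a; exact clActConv_smul q c a u u')

lemma clAct_ι (u : Uq q) (x : Vad k) : clAct q c u (Clq.ι q c x) = Clq.ι q c (rhoV q u x) :=
  clActConv_ι q c x u

lemma clAct_one (u : Uq q) : clAct q c u 1 = Uq.counit q u • 1 := by
  have h := clActConv_algebraMap q c 1 u
  rw [map_one, one_mul] at h
  exact h

/-- `u ▷ (a b) = ∑ (u₍₁₎ ▷ a) (u₍₂₎ ▷ b)`. -/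
lemma clAct_mul (u : Uq q) (a b : Clq q c) :
    clAct q c u (a * b) = LinearMap.mul' k _ (TensorProduct.map
      ((clAct q c).toLinearMap.flip a) ((clAct q c).toLinearMap.flip b) (Uq.comul q u)) :=
  clActConv_mul q c a b u

/-! ### The `q`-deformed noncommutative Weil algebra -/

/-- The `R`-matrix braiding `Cl_q(sl₂) ⊗ U_q(sl₂) → U_q(sl₂) ⊗ Cl_q(sl₂)`. -/
noncomputable def sigmaW : Clq q c ⊗[k] Uq q →ₗ[k] Uq q ⊗[k] Clq q c :=
  braid q (clAct q c) (ad q) (weightUq q)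

/-- The space underlying `W_q(sl₂) = U_q(sl₂) ⊗_R Cl_q(sl₂)`. -/
def Wq : Type _ := Uq q ⊗[k] Clq q c

noncomputable instance : AddCommGroup (Wq q c) := inferInstanceAs (AddCommGroup (Uq q ⊗[k] Clq q c))
noncomputable instance : Module k (Wq q c) := inferInstanceAs (Module k (Uq q ⊗[k] Clq q c))

namespace Wq

/-- The element `x ⊗ v` of `W_q(sl₂)`. -/
noncomputable def tmul (x : Uq q) (v : Clq q c) : Wq q c := x ⊗ₜ[k] v

/-- The multiplication `(m_U ⊗ m_Cl) ∘ (id ⊗ σ_R ⊗ id)`. -/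
noncomputable def mulMap :
    (Uq q ⊗[k] Clq q c) ⊗[k] (Uq q ⊗[k] Clq q c) →ₗ[k] Uq q ⊗[k] Clq q c :=
  TensorProduct.map (LinearMap.mul' k (Uq q)) (LinearMap.mul' k (Clq q c)) ∘ₗ
    (TensorProduct.assoc k (Uq q) (Uq q) (Clq q c ⊗[k] Clq q c)).symm.toLinearMap ∘ₗ
    ((TensorProduct.assoc k (Uq q) (Clq q c) (Clq q c)).toLinearMap ∘ₗ
      (sigmaW q c).rTensor (Clq q c) ∘ₗ
      (TensorProduct.assoc k (Clq q c) (Uq q) (Clq q c)).symm.toLinearMap).lTensor (Uq q) ∘ₗ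
    (TensorProduct.assoc k (Uq q) (Clq q c) (Uq q ⊗[k] Clq q c)).toLinearMap

noncomputable instance : Mul (Wq q c) := ⟨fun a b => mulMap q c (a ⊗ₜ b)⟩

noncomputable instance : NonUnitalNonAssocRing (Wq q c) where
  left_distrib a b d := (congrArg (mulMap q c) (TensorProduct.tmul_add a b d)).trans (map_add _ _ _)
  right_distrib a b d :=
    (congrArg (mulMap q c) (TensorProduct.add_tmul a b d)).trans (map_add _ _ _)
  zero_mul a := (congrArg (mulMap q c) (TensorProduct.zero_tmul _ a)).trans (map_zero _)
  mul_zero a := (congrArg (mulMap q c) (TensorProduct.tmul_zero _ a)).trans (map_zero _)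

lemma tmul_mul_tmul (x y : Uq q) (v w : Clq q c) : tmul q c x v * tmul q c y w =
    TensorProduct.map (LinearMap.mulLeft k x) (LinearMap.mulRight k w) (sigmaW q c (v ⊗ₜ y)) := by
  change mulMap q c ((x ⊗ₜ v) ⊗ₜ (y ⊗ₜ w)) = _
  simp only [mulMap, LinearMap.comp_apply, LinearEquiv.coe_coe, TensorProduct.assoc_tmul,
    LinearMap.lTensor_tmul, TensorProduct.assoc_symm_tmul, LinearMap.rTensor_tmul]
  induction sigmaW q c (v ⊗ₜ y) with
  | zero => simp
  | add a b ha hb => simp only [TensorProduct.add_tmul, TensorProduct.tmul_add, map_add, ha, hb]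
  | tmul a b => simp

end Wq

/-! ### The cubic Dirac element -/

/-- `X = v₂ = E`. -/
noncomputable def X : Uq q := Uq.E q

/-- `Z = v₀ = q⁻² E F - F E`. -/
noncomputable def Z : Uq q := (q ^ 2)⁻¹ • (Uq.E q * Uq.F q) - Uq.F q * Uq.E q

/-- `Y = v₋₂ = K F`. -/
noncomputable def Y : Uq q := Uq.K q * Uq.F q

/-- The quantum Casimir `C = E F + (q⁻¹ K + q K⁻¹) / (q - q⁻¹)²`. -/
noncomputable def casimir : Uq q :=
  Uq.E q * Uq.F q + ((q - q⁻¹) ^ 2)⁻¹ • (q⁻¹ • Uq.K q + q • Uq.Kinv q)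

/-- The generator `v₂` of `Cl_q(sl₂)`. -/
noncomputable def v2 : Clq q c := Clq.ι q c (vb k 0)

/-- The generator `v₀` of `Cl_q(sl₂)`. -/
noncomputable def v0 : Clq q c := Clq.ι q c (vb k 1)

/-- The generator `v₋₂` of `Cl_q(sl₂)`. -/
noncomputable def vm2 : Clq q c := Clq.ι q c (vb k 2)

open Wq in
/-- The cubic Dirac element `D_q`. -/
noncomputable def Dq : Wq q c :=
  (1 / c) • (tmul q c (X q) (vm2 q c) + (q / (1 + q ^ 2)) • tmul q c (Z q) (v0 q c) +
      (q ^ 2)⁻¹ • tmul q c (Y q) (v2 q c)) -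
    ((q ^ 2 - 1) ^ 2 / (2 * q * (q ^ 2 + 1) * c ^ 2)) •
      tmul q c (casimir q) (v2 q c * v0 q c * vm2 q c + c • v0 q c)

end

end QWeil

/-! Write `D_q = A/c - λ (C ⊗ γ)`, with `A` the linear part, `γ = v₂v₀v₋₂ + c v₀` (`cubic`) and `λ =
(q²-1)²/(2q(q²+1)c²)`. Everything rests on `C` and `γ` being transparent to the braiding. The
Casimir `C` is central in `U_q(sl₂)`, so it is `ad`-invariant and of weight `0`. The element `γ` is
killed by `E`, fixed by `K`, commutes with `v₂, v₀, v₋₂`, and has the scalar square `γ² =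
c³(q²+1)/q`. Hence `A (C ⊗ γ) = (C ⊗ γ) A`, and both are `C` times `A` with its Clifford factors
multiplied by `γ`, written `Aγ` below.

The only genuine braiding is in `A²`. The map `v₂, v₀, v₋₂ ↦ X, Z, Y` intertwines `F` and preserves
weights. By naturality (`braid_map`), a Clifford generator therefore moves past `X`, `Z`, `Y` by the
explicit matrix of `σ_R` on `V ⊗ V` (`tmul_generator_mul`). Normal ordering then gives
(`linear_part_sq`) `A² = (q²-1)²/(q(q²+1)) · C · (Aγ)/c + c(q²-1)²/(q(q²+1)) · C² -
cq(q²+1)/(q²-1)²`.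

The coefficient `λ` is chosen so that the cross terms `-(2λ/c) C · (Aγ)` of `D_q²` cancel the first
summand of `A²/c²`. What remains is a scalar plus a multiple of `C²`, to which `λ² C² γ²`
contributes; the two `C²` terms combine through `1 + (q²-1)²/(4q²) = (q²+1)²/(4q²)`.

Centrality then reduces to that of `C ⊗ 1` and `1 ⊗ 1`. The product on `Wq` carries only a
nonassociative ring structure here, so `Set.center` also asks for associativity identities, which
are checked for these two elements. -/

namespace QWeil

/-! ### Clifford relations from the eigenvectors of the braiding -/

section Clifford
variable {k : Type*} [Field k] (q c : k) [IsGeneric q]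

lemma normBraid_apply_of_sigmaV_eq_smul (i : Fin 3) {t : Vad k ⊗[k] Vad k}
    (h : sigmaV q t = sigmaVEigenvalue q i • t) :
    normBraid q t = (![1, -1, 1] : Fin 3 → k) i • t := by
  rw [normBraid_eq, spectral, Module.End.aeval_apply_of_mem_apply_eq_smul h,
    Lagrange.eval_interpolate_at_node _ (sigmaVEigenvalue_injective q).injOn (Finset.mem_univ i)]

/-- On vectors fixed by `σ̃`, that is on `V_{4π} ⊕ V_0`, the defining relation reads `2t = 2⟨t⟩`,
and characteristic zero allows division by `2`. Every relation below is this one applied to an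
explicit eigenvector of `σ_R`. -/
lemma Clq.ιι_of_normBraid_eq [CharZero k] {t : Vad k ⊗[k] Vad k} (h : normBraid q t = t) :
    Clq.ιι q c t = algebraMap k _ (TensorProduct.lift (formV q c) t) := by
  have h1 := Clq.ιι_add q c t
  rw [h, ← two_smul k, ← smul_eq_mul (2 : k), Algebra.algebraMap_eq_smul_one, smul_assoc] at h1
  rw [Algebra.algebraMap_eq_smul_one]
  exact smul_right_injective _ (two_ne_zero (α := k)) h1

lemma Clq.ιι_tmul (x y : Vad k) : Clq.ιι q c (x ⊗ₜ y) = Clq.ι q c x * Clq.ι q c y := by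
  simp [Clq.ιι]

variable [CharZero k]

lemma v2_mul_v2 : v2 q c * v2 q c = 0 := by
  have h : normBraid q (vb k 0 ⊗ₜ vb k 0) = vb k 0 ⊗ₜ vb k 0 := by
    simpa using normBraid_apply_of_sigmaV_eq_smul q 0 (t := vb k 0 ⊗ₜ vb k 0)
      (by simp [sigmaV_vb, sigmaVEigenvalue])
  simpa [Clq.ιι_tmul, formV_vb, v2, vm2] using Clq.ιι_of_normBraid_eq q c h

lemma vm2_mul_vm2 : vm2 q c * vm2 q c = 0 := by
  have h : normBraid q (vb k 2 ⊗ₜ vb k 2) = vb k 2 ⊗ₜ vb k 2 := by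
    simpa using normBraid_apply_of_sigmaV_eq_smul q 0 (t := vb k 2 ⊗ₜ vb k 2)
      (by simp [sigmaV_vb, sigmaVEigenvalue])
  simpa [Clq.ιι_tmul, formV_vb, v2, vm2] using Clq.ιι_of_normBraid_eq q c h

lemma v0_mul_v2 : v0 q c * v2 q c = -((q ^ 2)⁻¹ • (v2 q c * v0 q c)) := by
  have h0 := q_ne q
  have h := normBraid_apply_of_sigmaV_eq_smul q 0
    (t := (q ^ 2)⁻¹ • vb k 0 ⊗ₜ[k] vb k 1 + vb k 1 ⊗ₜ vb k 0) (by
      simp only [map_add, map_smul, sigmaV_vb, sigmaVEigenvalue, Matrix.cons_val]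
      match_scalars <;> field_simp <;> ring)
  have h1 := Clq.ιι_of_normBraid_eq q c (h.trans (one_smul _ _))
  simp [Clq.ιι_tmul, formV_vb] at h1
  exact eq_neg_of_add_eq_zero_right h1

lemma vm2_mul_v0 : vm2 q c * v0 q c = -((q ^ 2)⁻¹ • (v0 q c * vm2 q c)) := by
  have h0 := q_ne q
  have h := normBraid_apply_of_sigmaV_eq_smul q 0
    (t := (q ^ 2)⁻¹ • vb k 1 ⊗ₜ[k] vb k 2 + vb k 2 ⊗ₜ vb k 1) (by
      simp only [map_add, map_smul, sigmaV_vb, sigmaVEigenvalue, Matrix.cons_val]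
      match_scalars <;> field_simp <;> ring)
  have h1 := Clq.ιι_of_normBraid_eq q c (h.trans (one_smul _ _))
  simp [Clq.ιι_tmul, formV_vb] at h1
  exact eq_neg_of_add_eq_zero_right h1

/-- Comes from the weight-zero vector of `V_{4π}`, on which the form vanishes. -/
lemma v2_mul_vm2_relation_four :
    v2 q c * vm2 q c - q ^ 3 • (v0 q c * v0 q c) + q ^ 4 • (vm2 q c * v2 q c) = 0 := by
  have h0 := q_ne q
  have h := normBraid_apply_of_sigmaV_eq_smul q 0
    (t := vb k 0 ⊗ₜ[k] vb k 2 - q ^ 3 • vb k 1 ⊗ₜ vb k 1 + q ^ 4 • vb k 2 ⊗ₜ vb k 0) (by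
      simp only [map_add, map_sub, map_smul, sigmaV_vb, sigmaVEigenvalue, Matrix.cons_val]
      match_scalars <;> field_simp <;> ring)
  have h1 := Clq.ιι_of_normBraid_eq q c (h.trans (one_smul _ _))
  simp only [Clq.ιι_tmul, formV_vb, map_add, map_sub, map_smul, TensorProduct.lift.tmul,
    Matrix.cons_val] at h1
  refine h1.trans ?_
  rw [← map_sub, ← map_add, ← map_zero (algebraMap k _)]
  congr 1
  simp only [smul_eq_mul]
  field_simp
  ring

/-- Comes from the invariant vector spanning `V_0`; the right side is its value under the form, `c(1
+ q⁻² + q⁻⁴)`. -/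
lemma v2_mul_vm2_relation_zero :
    v2 q c * vm2 q c + (q / (q ^ 2 + 1)) • (v0 q c * v0 q c) + (q ^ 2)⁻¹ • (vm2 q c * v2 q c) =
      (c * (q ^ 4 + q ^ 2 + 1) / q ^ 4) • 1 := by
  have h0 := q_ne q
  have h2 := q_sq_add_one_ne q
  have h := normBraid_apply_of_sigmaV_eq_smul q 2
    (t := vb k 0 ⊗ₜ[k] vb k 2 + (q / (q ^ 2 + 1)) • vb k 1 ⊗ₜ vb k 1 +
      (q ^ 2)⁻¹ • vb k 2 ⊗ₜ vb k 0) (by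
      simp only [map_add, map_smul, sigmaV_vb, sigmaVEigenvalue, Matrix.cons_val]
      match_scalars <;> field_simp <;> ring)
  have h1 := Clq.ιι_of_normBraid_eq q c (h.trans (one_smul _ _))
  simp only [Clq.ιι_tmul, formV_vb, map_add, map_smul, TensorProduct.lift.tmul,
    Matrix.cons_val] at h1
  refine h1.trans ?_
  rw [← map_add, ← map_add, Algebra.algebraMap_eq_smul_one]
  congr 1
  simp only [smul_eq_mul]
  field_simp
  ring

lemma vm2_mul_v2 : vm2 q c * v2 q c = -(v2 q c * vm2 q c) + (c * (q ^ 2 + 1) / q ^ 2) • 1 := by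
  have h0 := q_ne q
  have h2 := q_sq_add_one_ne q
  have h3 := q_fourth_add_sq_add_one_ne q
  have h4 : q ^ 2 * (q ^ 2 + 1) + 1 ≠ 0 := by convert h3 using 1; ring
  have e4 := v2_mul_vm2_relation_four q c
  have e0 := v2_mul_vm2_relation_zero q c
  rw [← sub_eq_zero] at e0 ⊢
  -- The combination of the two weight-zero relations in `e` eliminates `v₀²` and leaves `v₂v₋₂` and
  -- `v₋₂v₂` with the common coefficient `q³(q⁴+q²+1)`, nonzero because `q` is not a root of unity.
  rw [← smul_eq_zero_iff_right (mul_ne_zero (pow_ne_zero 3 h0) h3)]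
  have e := congrArg₂ (fun a b => (q ^ 3) • a + (q ^ 5 * (q ^ 2 + 1)) • b) e4 e0
  simp only [smul_zero, add_zero] at e
  rw [← e]
  match_scalars <;> field_simp <;> ring

lemma v0_mul_v0 : v0 q c * v0 q c =
    ((1 - q ^ 4) / q ^ 3) • (v2 q c * vm2 q c) + (c * (q ^ 2 + 1) / q) • 1 := by
  have h0 := q_ne q
  have e4 := v2_mul_vm2_relation_four q c
  rw [vm2_mul_v2] at e4
  rw [← sub_eq_zero, ← smul_eq_zero_iff_right (neg_ne_zero.2 (pow_ne_zero 3 h0)), ← e4]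
  match_scalars <;> field_simp <;> ring

end Clifford

/-! ### Casimir, grading and the copy of `V_{2π}` in `U_q(sl₂)` -/

section Algebra
variable {k : Type*} [Field k] (q : k) [IsGeneric q]

namespace Uq

lemma E_mul_F_mul (a : Uq q) :
    E q * (F q * a) = F q * (E q * a) + (q - q⁻¹)⁻¹ • (K q * a - Kinv q * a) := by
  rw [← mul_assoc, E_mul_F, add_mul, mul_assoc, smul_mul_assoc, sub_mul]

lemma K_mul_E_mul (a : Uq q) : K q * (E q * a) = q ^ 2 • (E q * (K q * a)) := by
  rw [← mul_assoc, K_mul_E, smul_mul_assoc, mul_assoc]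

lemma K_mul_F_mul (a : Uq q) : K q * (F q * a) = (q ^ 2)⁻¹ • (F q * (K q * a)) := by
  rw [← mul_assoc, K_mul_F, smul_mul_assoc, mul_assoc]

lemma Kinv_mul_E_mul (a : Uq q) : Kinv q * (E q * a) = (q ^ 2)⁻¹ • (E q * (Kinv q * a)) := by
  rw [← mul_assoc, Kinv_mul_E, smul_mul_assoc, mul_assoc]

lemma Kinv_mul_F_mul (a : Uq q) : Kinv q * (F q * a) = q ^ 2 • (F q * (Kinv q * a)) := by
  rw [← mul_assoc, Kinv_mul_F, smul_mul_assoc, mul_assoc]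

lemma K_mul_Kinv_mul (a : Uq q) : K q * (Kinv q * a) = a := by
  rw [← mul_assoc, K_mul_Kinv, one_mul]

lemma Kinv_mul_K_mul (a : Uq q) : Kinv q * (K q * a) = a := by
  rw [← mul_assoc, Kinv_mul_K, one_mul]

end Uq

open Uq

/-- The form of `C` adapted to the ordering `F`, `E`, `K^{±1}` used in all normal-ordering
computations. -/
lemma casimir_eq : casimir q = F q * E q +
    ((q - q⁻¹) ^ 2)⁻¹ • (q • K q + q⁻¹ • Kinv q) := by
  have h0 := q_ne q
  have h1 := q_sq_sub_one_ne q
  have h2 := q_sub_inv_ne q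
  rw [casimir, E_mul_F]
  match_scalars <;> field_simp <;> ring

lemma casimir_commute (u : Uq q) : Commute (casimir q) u := by
  have h0 := q_ne q
  have h1 := q_sq_sub_one_ne q
  induction u using Uq.induction with
  | algebraMap r => exact (Algebra.commutes r _).symm
  | mul a b ha hb => exact ha.mul_right hb
  | add a b ha hb => exact ha.add_right hb
  | _ =>
    simp only [Commute, SemiconjBy, casimir_eq, add_mul, mul_add, mul_smul_comm,
      smul_mul_assoc, mul_assoc, K_mul_E,
      K_mul_F, Kinv_mul_E, Kinv_mul_F, E_mul_F, E_mul_F_mul, K_mul_F_mul,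
      Kinv_mul_F_mul, K_mul_Kinv, Kinv_mul_K,
      mul_sub]
    match_scalars <;> field_simp <;> ring

/-- The equivariant embedding `v₂ ↦ X`, `v₀ ↦ Z`, `v₋₂ ↦ Y` of `V_{2π}` into `U_q(sl₂)`. -/
noncomputable def adEmbed : Vad k →ₗ[k] Uq q := Fintype.linearCombination k ![X q, Z q, Y q]

lemma adEmbed_vb (i : Fin 3) : adEmbed q (vb k i) = ![X q, Z q, Y q] i := by
  simp [adEmbed, vb, Fintype.linearCombination_apply_single]

lemma vad_ext {P : Type*} [AddCommGroup P] [Module k P] {f g : Vad k →ₗ[k] P}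
    (h : ∀ i, f (vb k i) = g (vb k i)) : f = g := by
  apply LinearMap.pi_ext'
  intro i
  ext
  simpa [vb] using h i

/-- Only `F` is needed: in `R` the second tensor leg sees powers of `F` and the weight, and the
weight is treated by `weightUq_adEmbed`. -/
lemma ad_F_comp_adEmbed : ad q (F q) ∘ₗ adEmbed q = adEmbed q ∘ₗ rhoV q (F q) := by
  have h0 := q_ne q
  have h1 := q_sq_sub_one_ne q
  apply vad_ext
  intro i
  rw [LinearMap.comp_apply, LinearMap.comp_apply, rhoV_F, adEmbed_vb, ad_F]
  fin_cases i <;>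
  · simp only [Fin.zero_eta, Fin.mk_one, Fin.reduceFinMk, Matrix.cons_val, map_neg, map_smul,
      map_zero, adEmbed_vb]
    simp only [X, Y, Z, add_mul, mul_add, mul_smul_comm, smul_mul_assoc, mul_assoc,
      K_mul_F, Kinv_mul_E, Kinv_mul_F, E_mul_F,
      Kinv_mul_F_mul, Kinv_mul_K,
      mul_sub, sub_mul, mul_one, one_mul]
    match_scalars <;> field_simp <;> ring

lemma weightUq_eq_single {n : ℤ} {u : Uq q} (h : gradingUq q u = AddMonoidAlgebra.single n u) :
    weightUq q u = Finsupp.single n u := by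
  change (gradingUq q u).coeff = _
  rw [h]; rfl

lemma gradingUq_E : gradingUq q (E q) = AddMonoidAlgebra.single 1 (E q) := by
  rw [gradingUq, lift_E, LaurentPolynomial.single_eq_C_mul_T]

lemma gradingUq_F : gradingUq q (F q) = AddMonoidAlgebra.single (-1) (F q) := by
  rw [gradingUq, lift_F, LaurentPolynomial.single_eq_C_mul_T]

lemma gradingUq_K : gradingUq q (K q) = AddMonoidAlgebra.single 0 (K q) := by
  rw [gradingUq, lift_K, LaurentPolynomial.single_eq_C]

lemma gradingUq_Kinv : gradingUq q (Kinv q) = AddMonoidAlgebra.single 0 (Kinv q) := by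
  rw [gradingUq, lift_Kinv, LaurentPolynomial.single_eq_C]

lemma gradingUq_casimir : gradingUq q (casimir q) = AddMonoidAlgebra.single 0 (casimir q) := by
  simp [-LaurentPolynomial.single_eq_C_mul_T, -LaurentPolynomial.single_eq_C,
    casimir, gradingUq_E, gradingUq_F, gradingUq_K, gradingUq_Kinv,
    AddMonoidAlgebra.single_mul_single, AddMonoidAlgebra.single_add, AddMonoidAlgebra.smul_single]

lemma weightUq_adEmbed (i : Fin 3) :
    weightUq q (adEmbed q (vb k i)) = Finsupp.single (wtV i) (adEmbed q (vb k i)) := by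
  rw [adEmbed_vb]
  apply weightUq_eq_single
  fin_cases i <;>
  simp [-LaurentPolynomial.single_eq_C_mul_T, -LaurentPolynomial.single_eq_C,
    X, Y, Z, wtV, gradingUq_E, gradingUq_F, gradingUq_K, AddMonoidAlgebra.single_mul_single,
    AddMonoidAlgebra.single_sub, AddMonoidAlgebra.smul_single]

lemma weightUq_sum (u : Uq q) : (weightUq q u).sum (fun _ y => y) = u := by
  -- Setting `T = 1` is a left inverse of the grading coaction, as is checked on generators, and it
  -- adds up the coefficients of a Laurent polynomial.
  let φ : LaurentPolynomial (Uq q) →ₐ[k] Uq q :=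
    AddMonoidAlgebra.liftNCAlgHom (AlgHom.id k (Uq q)) (1 : Multiplicative ℤ →* Uq q)
      (fun _ _ => Commute.one_right _)
  have hφ (n : ℤ) (y : Uq q) : φ (AddMonoidAlgebra.single n y) = y := by
    change AddMonoidAlgebra.liftNC _ _ _ = _
    rw [AddMonoidAlgebra.liftNC_single]
    simp
  have hs (p : LaurentPolynomial (Uq q)) : φ p = p.coeff.sum fun _ y => y := by
    change AddMonoidAlgebra.liftNC _ _ p = _
    simp [AddMonoidAlgebra.liftNC]
  have h : φ.comp (gradingUq q) = AlgHom.id k (Uq q) := by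
    apply algHom_ext <;>
      simp only [AlgHom.comp_apply, gradingUq_E, gradingUq_F, gradingUq_K, gradingUq_Kinv, hφ,
        AlgHom.id_apply]
  exact (hs _).symm.trans (DFunLike.congr_fun h u)

lemma weightUq_casimir_mul (u : Uq q) :
    weightUq q (casimir q * u) =
      Finsupp.mapRange.linearMap (LinearMap.mulLeft k (casimir q)) (weightUq q u) := by
  change (gradingUq q _).coeff = Finsupp.mapRange.linearMap _ (gradingUq q u).coeff
  rw [map_mul, gradingUq_casimir]
  ext n
  simp [-LaurentPolynomial.single_eq_C_mul_T, -LaurentPolynomial.single_eq_C]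

/-- A central factor passes through every term of the adjoint action. -/
lemma ad_F_casimir_mul (u : Uq q) : ad q (F q) (casimir q * u) = casimir q * ad q (F q) u := by
  rw [ad_F, ad_F, mul_sub, ← mul_assoc, ← mul_assoc (Kinv q), ← (casimir_commute q (F q)).eq,
    ← (casimir_commute q (Kinv q)).eq]
  simp only [mul_assoc]

end Algebra

/-! ### Naturality of the `R`-matrix braiding, and when it is the flip -/

section BraidingLemmas
variable {k : Type*} [Field k] (q : k) [IsGeneric q]
variable {M N M' N' : Type*} [AddCommGroup M] [Module k M] [AddCommGroup N] [Module k N]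
  [AddCommGroup M'] [Module k M'] [AddCommGroup N'] [Module k N']
  (ρM : Uq q →ₐ[k] Module.End k M) (ρN : Uq q →ₐ[k] Module.End k N)
  (wN : N →ₗ[k] ℤ →₀ N)
  (ρM' : Uq q →ₐ[k] Module.End k M') (ρN' : Uq q →ₐ[k] Module.End k N')
  (wN' : N' →ₗ[k] ℤ →₀ N')

/-- Nilpotency of `E` on the first leg makes the series finite; for infinite support `finsum` would
take its default value `0`. -/
lemma braidR1_eq_sum_range {n : ℕ} (h : ρM (Uq.E q ^ n) = 0) :
    braidR1 q ρM ρN = ∑ m ∈ Finset.range n,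
      (q ^ m.choose 2 * (q - q⁻¹) ^ m / qFactorial q m) •
        TensorProduct.map (ρM (Uq.E q ^ m)) (ρN (Uq.F q ^ m)) := by
  apply finsum_eq_range
  intro m hm
  rw [← Nat.sub_add_cancel hm, pow_add (Uq.E q), map_mul, h, mul_zero,
    TensorProduct.map_zero_left, smul_zero]

lemma braidR0_tmul (v : M) (y : N) : braidR0 q ρM wN (v ⊗ₜ y) =
    (wN y).sum fun b y' => ρM ((Uq.Kunit q ^ b : (Uq q)ˣ) : Uq q) v ⊗ₜ y' := by
  rw [braidR0, LinearMap.comp_apply, LinearMap.comp_apply, LinearMap.lTensor_tmul,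
    LinearEquiv.coe_coe]
  induction wN y using Finsupp.induction_linear with
  | zero => simp
  | add f g hf hg =>
    rw [TensorProduct.tmul_add, map_add, map_add, hf, hg, Finsupp.sum_add_index'] <;>
      simp [TensorProduct.tmul_add]
  | single b y' =>
    rw [TensorProduct.finsuppRight_tmul_single, Finsupp.sum_single_index (by simp)]
    simp

/-- Each term of `R` is built from `E`, `K` on the first leg and `F`, weight on the second. So `f`
must be equivariant, while `g` need only intertwine `F` and preserve weight components. -/
lemma braid_map {n : ℕ} (h : ρM (Uq.E q ^ n) = 0) (h' : ρM' (Uq.E q ^ n) = 0)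
    (f : M →ₗ[k] M') (g : N →ₗ[k] N') (hf : ∀ u, f ∘ₗ ρM u = ρM' u ∘ₗ f)
    (hg : g ∘ₗ ρN (Uq.F q) = ρN' (Uq.F q) ∘ₗ g)
    (hw : wN' ∘ₗ g = Finsupp.mapRange.linearMap g ∘ₗ wN) :
    braid q ρM' ρN' wN' ∘ₗ TensorProduct.map f g =
      TensorProduct.map g f ∘ₗ braid q ρM ρN wN := by
  have hgm (m : ℕ) : g ∘ₗ ρN (Uq.F q ^ m) = ρN' (Uq.F q ^ m) ∘ₗ g := by
    induction m with
    | zero => simp [Module.End.one_eq_id]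
    | succ m ih =>
      rw [pow_succ, map_mul, map_mul, Module.End.mul_eq_comp, Module.End.mul_eq_comp,
        ← LinearMap.comp_assoc, ih, LinearMap.comp_assoc, hg, LinearMap.comp_assoc]
  have h1 : braidR1 q ρM' ρN' ∘ₗ TensorProduct.map f g =
      TensorProduct.map f g ∘ₗ braidR1 q ρM ρN := by
    rw [braidR1_eq_sum_range q ρM ρN h, braidR1_eq_sum_range q ρM' ρN' h']
    refine TensorProduct.ext' fun v y => ?_
    simp only [LinearMap.comp_apply, LinearMap.sum_apply, map_sum, TensorProduct.map_tmul,
      LinearMap.smul_apply, map_smul]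
    refine Finset.sum_congr rfl fun m _ => ?_
    rw [← LinearMap.comp_apply, ← hf, ← LinearMap.comp_apply _ g, ← hgm, LinearMap.comp_apply,
      LinearMap.comp_apply]
  have h0 : braidR0 q ρM' wN' ∘ₗ TensorProduct.map f g =
      TensorProduct.map f g ∘ₗ braidR0 q ρM wN := by
    ext v y
    simp only [TensorProduct.AlgebraTensorModule.curry_apply, LinearMap.restrictScalars_self,
      TensorProduct.curry_apply, LinearMap.comp_apply, TensorProduct.map_tmul, braidR0_tmul]
    rw [← LinearMap.comp_apply, hw, LinearMap.comp_apply, Finsupp.mapRange.linearMap_apply,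
      Finsupp.sum_mapRange_index (by simp), map_finsuppSum]
    refine Finset.sum_congr rfl fun b _ => ?_
    beta_reduce
    rw [TensorProduct.map_tmul, ← LinearMap.comp_apply, ← LinearMap.comp_apply, hf]
  rw [braid, braid, LinearMap.comp_assoc, LinearMap.comp_assoc, h1,
    ← LinearMap.comp_assoc _ _ (braidR0 q ρM' wN'), h0]
  ext v y
  simp only [TensorProduct.AlgebraTensorModule.curry_apply, LinearMap.restrictScalars_self,
      TensorProduct.curry_apply, LinearMap.comp_apply, LinearEquiv.coe_coe, TensorProduct.map_comm]

lemma braidR1_tmul_of_E {n : ℕ} (h : ρM (Uq.E q ^ n) = 0) {v : M} (hv : ρM (Uq.E q) v = 0)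
    (y : N) : braidR1 q ρM ρN (v ⊗ₜ y) = v ⊗ₜ y := by
  -- Passing to `n + 1` ensures that the range contains `m = 0`, the only surviving term, even if `n
  -- = 0`.
  have h' : ρM (Uq.E q ^ (n + 1)) = 0 := by rw [pow_succ, map_mul, h, zero_mul]
  rw [braidR1_eq_sum_range q ρM ρN h', Finset.sum_range_succ']
  simp [pow_succ, hv, qFactorial]

lemma braidR1_tmul_of_F {n : ℕ} (h : ρM (Uq.E q ^ n) = 0) (v : M) {y : N}
    (hy : ρN (Uq.F q) y = 0) : braidR1 q ρM ρN (v ⊗ₜ y) = v ⊗ₜ y := by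
  have h' : ρM (Uq.E q ^ (n + 1)) = 0 := by rw [pow_succ, map_mul, h, zero_mul]
  rw [braidR1_eq_sum_range q ρM ρN h', Finset.sum_range_succ']
  simp [pow_succ, hy, qFactorial]

lemma Kunit_zpow_apply {v : M} (hv : ρM (Uq.K q) v = v) (b : ℤ) :
    ρM ((Uq.Kunit q ^ b : (Uq q)ˣ) : Uq q) v = v := by
  let K' : (Module.End k M)ˣ := Units.map (ρM : Uq q →* Module.End k M) (Uq.Kunit q)
  -- The stabilizer of `v` is a subgroup, so negative powers of `K` are covered as well.
  have h : K' ∈ MulAction.stabilizer (Module.End k M)ˣ v := hv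
  have h2 := MulAction.mem_stabilizer_iff.1 (zpow_mem h b)
  rw [← map_zpow] at h2
  exact h2

/-- Braiding past an invariant vector on the left is the flip. -/
lemma braid_tmul_of_invariant_left {n : ℕ} (h : ρM (Uq.E q ^ n) = 0) {v : M}
    (hE : ρM (Uq.E q) v = 0) (hK : ρM (Uq.K q) v = v) {y : N}
    (hy : (wN y).sum (fun _ y' => y') = y) : braid q ρM ρN wN (v ⊗ₜ y) = y ⊗ₜ v := by
  rw [braid, LinearMap.comp_apply, LinearMap.comp_apply, braidR1_tmul_of_E q ρM ρN h hE,
    braidR0_tmul]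
  simp only [Kunit_zpow_apply q ρM hK]
  rw [Finsupp.sum, ← TensorProduct.tmul_sum]
  change TensorProduct.comm k M N (v ⊗ₜ (wN y).sum fun _ y' => y') = _
  rw [hy, TensorProduct.comm_tmul]

/-- Braiding past an invariant vector on the right is the flip. -/
lemma braid_tmul_of_invariant_right {n : ℕ} (h : ρM (Uq.E q ^ n) = 0) (v : M) {y : N}
    (hF : ρN (Uq.F q) y = 0) (hw : wN y = Finsupp.single 0 y) :
    braid q ρM ρN wN (v ⊗ₜ y) = y ⊗ₜ v := by
  rw [braid, LinearMap.comp_apply, LinearMap.comp_apply, braidR1_tmul_of_F q ρM ρN h v hF,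
    braidR0_tmul, hw, Finsupp.sum_single_index (by simp)]
  simp

end BraidingLemmas

/-! ### Monomials, the action on `Cl_q(sl₂)` and the invariant cubic element -/

section CliffordModule
variable {k : Type*} [Field k] (q c : k) [IsGeneric q] [CharZero k]

lemma v2_mul_v2_mul (a : Clq q c) : v2 q c * (v2 q c * a) = 0 := by
  rw [← mul_assoc, v2_mul_v2, zero_mul]

lemma vm2_mul_vm2_mul (a : Clq q c) : vm2 q c * (vm2 q c * a) = 0 := by
  rw [← mul_assoc, vm2_mul_vm2, zero_mul]

lemma v0_mul_v2_mul (a : Clq q c) :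
    v0 q c * (v2 q c * a) = -((q ^ 2)⁻¹ • (v2 q c * (v0 q c * a))) := by
  rw [← mul_assoc, v0_mul_v2, neg_mul, smul_mul_assoc, mul_assoc]

lemma vm2_mul_v0_mul (a : Clq q c) :
    vm2 q c * (v0 q c * a) = -((q ^ 2)⁻¹ • (v0 q c * (vm2 q c * a))) := by
  rw [← mul_assoc, vm2_mul_v0, neg_mul, smul_mul_assoc, mul_assoc]

lemma vm2_mul_v2_mul (a : Clq q c) : vm2 q c * (v2 q c * a) =
    -(v2 q c * (vm2 q c * a)) + (c * (q ^ 2 + 1) / q ^ 2) • a := by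
  rw [← mul_assoc, vm2_mul_v2, add_mul, neg_mul, smul_mul_assoc, mul_assoc, one_mul]

lemma v0_mul_v0_mul (a : Clq q c) : v0 q c * (v0 q c * a) =
    ((1 - q ^ 4) / q ^ 3) • (v2 q c * (vm2 q c * a)) + (c * (q ^ 2 + 1) / q) • a := by
  rw [← mul_assoc, v0_mul_v0, add_mul, smul_mul_assoc, smul_mul_assoc, mul_assoc, one_mul]

lemma ι_eq (x : Vad k) :
    Clq.ι q c x = x 0 • v2 q c + x 1 • v0 q c + x 2 • vm2 q c := by
  have hx : x = x 0 • vb k 0 + x 1 • vb k 1 + x 2 • vb k 2 := by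
    ext i; fin_cases i <;> simp [vb]
  conv_lhs => rw [hx]
  simp [v2, v0, vm2]

/-- The span contains `1` and is stable under left multiplication by the generators, because the
relations reorder every product. Linear independence is not needed. -/
lemma Clq.span_monomials_eq_top :
    Submodule.span k {1, v2 q c, v0 q c, vm2 q c, v2 q c * v0 q c, v2 q c * vm2 q c,
      v0 q c * vm2 q c, v2 q c * (v0 q c * vm2 q c)} = ⊤ := by
  set S := Submodule.span k {1, v2 q c, v0 q c, vm2 q c, v2 q c * v0 q c, v2 q c * vm2 q c,
      v0 q c * vm2 q c, v2 q c * (v0 q c * vm2 q c)} with hS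
  have hgen (x : Clq q c) (hx : x = v2 q c ∨ x = v0 q c ∨ x = vm2 q c) :
      ∀ b ∈ S, x * b ∈ S := by
    intro b hb
    induction hb using Submodule.span_induction with
    | zero => simp
    | add a b _ _ ha hb => rw [mul_add]; exact add_mem ha hb
    | smul r a _ ha => rw [mul_smul_comm]; exact S.smul_mem r ha
    | mem b hb =>
      simp only [Set.mem_insert_iff, Set.mem_singleton_iff] at hb
      rcases hx with rfl | rfl | rfl <;>
      rcases hb with rfl | rfl | rfl | rfl | rfl | rfl | rfl | rfl <;>
      · try simp only [mul_one, v2_mul_v2, vm2_mul_vm2, v0_mul_v2, vm2_mul_v0, vm2_mul_v2,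
          v0_mul_v0, v2_mul_v2_mul, v0_mul_v2_mul, vm2_mul_v0_mul,
          vm2_mul_v2_mul, v0_mul_v0_mul, mul_add, mul_neg, mul_smul_comm, mul_zero, smul_zero,
          neg_zero]
        repeat' first
          | exact zero_mem _
          | apply add_mem
          | apply neg_mem
          | apply Submodule.smul_mem
          | exact Submodule.subset_span (by simp)
  have hmul (a : Clq q c) : ∀ b ∈ S, a * b ∈ S := by
    induction a using Clq.induction with
    | algebraMap r => intro b hb; rw [← Algebra.smul_def]; exact S.smul_mem r hb
    | ι x =>
      intro b hb
      rw [ι_eq, add_mul, add_mul, smul_mul_assoc, smul_mul_assoc, smul_mul_assoc]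
      exact add_mem (add_mem (S.smul_mem _ (hgen _ (by simp) b hb))
        (S.smul_mem _ (hgen _ (by simp) b hb))) (S.smul_mem _ (hgen _ (by simp) b hb))
    | mul a a' ha ha' => intro b hb; rw [mul_assoc]; exact ha _ (ha' b hb)
    | add a a' ha ha' => intro b hb; rw [add_mul]; exact add_mem (ha b hb) (ha' b hb)
  rw [eq_top_iff]
  intro a _
  rw [← mul_one a]
  exact hmul a 1 (Submodule.subset_span (by simp))

omit [CharZero k] in
lemma clAct_E_mul (a b : Clq q c) : clAct q c (Uq.E q) (a * b) =
    clAct q c (Uq.E q) a * clAct q c (Uq.K q) b + a * clAct q c (Uq.E q) b := by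
  rw [clAct_mul]
  simp [Uq.comul]

omit [CharZero k] in
lemma clAct_K_mul (a b : Clq q c) : clAct q c (Uq.K q) (a * b) =
    clAct q c (Uq.K q) a * clAct q c (Uq.K q) b := by
  rw [clAct_mul]
  simp [Uq.comul]

lemma clAct_E_v2 : clAct q c (Uq.E q) (v2 q c) = 0 := by
  simp [v2, clAct_ι, rhoV_E]

lemma clAct_E_v0 : clAct q c (Uq.E q) (v0 q c) = -(q + q⁻¹) • v2 q c := by
  rw [v0, clAct_ι, rhoV_E]; simp [v2]

lemma clAct_E_vm2 : clAct q c (Uq.E q) (vm2 q c) = v0 q c := by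
  rw [vm2, clAct_ι, rhoV_E]; simp [v0]

lemma clAct_K_v2 : clAct q c (Uq.K q) (v2 q c) = q ^ 2 • v2 q c := by
  rw [v2, clAct_ι, rhoV_K]; simp

lemma clAct_K_v0 : clAct q c (Uq.K q) (v0 q c) = v0 q c := by
  rw [v0, clAct_ι, rhoV_K]; simp

lemma clAct_K_vm2 : clAct q c (Uq.K q) (vm2 q c) = (q ^ 2)⁻¹ • vm2 q c := by
  rw [vm2, clAct_ι, rhoV_K]; simp

/-- The invariant cubic element `v₂ v₀ v₋₂ + c v₀`. -/
noncomputable def cubic : Clq q c := v2 q c * v0 q c * vm2 q c + c • v0 q c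

/-- Applying `E` to `v₂v₀v₋₂` leaves `v₂v₀² = c(q+q⁻¹) v₂`; the correction `c v₀` is what cancels
it. -/
lemma clAct_E_cubic : clAct q c (Uq.E q) (cubic q c) = 0 := by
  have h0 := q_ne q
  simp only [cubic, map_add, map_smul, clAct_E_mul, clAct_E_v2, clAct_E_v0, clAct_E_vm2,
    clAct_K_vm2, zero_mul, zero_add, mul_smul_comm, smul_mul_assoc,
    mul_assoc, v0_mul_v0, mul_add, v2_mul_v2_mul, smul_zero, mul_one]
  match_scalars
  field_simp
  ring

lemma clAct_K_cubic : clAct q c (Uq.K q) (cubic q c) = cubic q c := by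
  have h0 := q_ne q
  simp only [cubic, map_add, map_smul, clAct_K_mul, clAct_K_v2, clAct_K_v0, clAct_K_vm2,
    mul_smul_comm, smul_mul_assoc]
  match_scalars <;> field_simp

/-- The eight spanning monomials have half-weights in `{-1, 0, 1}` and `E` raises the half-weight by
one. This makes `σ_R` on `Cl_q ⊗ U_q` a finite sum. -/
lemma clAct_E_pow_three : clAct q c (Uq.E q ^ 3) = 0 := by
  have h0 := q_ne q
  refine LinearMap.ext_on (Clq.span_monomials_eq_top q c) ?_
  intro b hb
  have hE1 : clAct q c (Uq.E q) 1 = 0 := by rw [clAct_one]; simp [Uq.counit]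
  simp only [Set.mem_insert_iff, Set.mem_singleton_iff] at hb
  rw [pow_succ, pow_two, map_mul, map_mul]
  rcases hb with rfl | rfl | rfl | rfl | rfl | rfl | rfl | rfl <;>
  · simp only [Module.End.mul_apply, LinearMap.zero_apply, map_add, map_smul, map_zero,
      clAct_E_mul, clAct_K_mul, hE1, clAct_E_v2,
      clAct_E_v0, clAct_E_vm2, clAct_K_v0, clAct_K_vm2, zero_mul, zero_add,
      mul_smul_comm, smul_mul_assoc, v2_mul_v2, mul_assoc, v0_mul_v0, mul_add,
      v2_mul_v2_mul, smul_zero, mul_one,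
      add_zero]
    try match_scalars <;> field_simp <;> ring

/-- Together with the next five lemmas: left and right multiplication by `γ` agree on each
generator. -/
lemma v2_mul_cubic : v2 q c * cubic q c = c • (v2 q c * v0 q c) := by
  simp only [cubic, mul_add, mul_assoc, v2_mul_v2_mul, zero_add, mul_smul_comm]

lemma v0_mul_cubic : v0 q c * cubic q c =
    -(c * (q ^ 2 + 1) / q) • (v2 q c * vm2 q c) + (c ^ 2 * (q ^ 2 + 1) / q) • 1 := by
  have h0 := q_ne q
  simp only [cubic, mul_add, mul_assoc, v0_mul_v2_mul, v0_mul_v0_mul, v0_mul_v0, vm2_mul_vm2,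
    mul_zero, smul_zero, zero_add, mul_smul_comm]
  match_scalars <;> field_simp <;> ring

lemma vm2_mul_cubic : vm2 q c * cubic q c = c • (v0 q c * vm2 q c) := by
  have h0 := q_ne q
  simp only [cubic, mul_add, mul_assoc, vm2_mul_v2_mul, vm2_mul_v0_mul, vm2_mul_v0, vm2_mul_vm2,
    mul_zero, smul_zero, zero_add, mul_smul_comm, neg_zero]
  match_scalars
  field_simp
  ring

lemma cubic_mul_v2 : cubic q c * v2 q c = c • (v2 q c * v0 q c) := by
  have h0 := q_ne q
  simp only [cubic, add_mul, mul_add, mul_assoc, vm2_mul_v2, v0_mul_v2_mul, v0_mul_v2, mul_neg,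
    v2_mul_v2_mul, smul_mul_assoc, mul_smul_comm, smul_zero, neg_zero, mul_one]
  match_scalars
  field_simp
  ring

lemma cubic_mul_v0 : cubic q c * v0 q c =
    -(c * (q ^ 2 + 1) / q) • (v2 q c * vm2 q c) + (c ^ 2 * (q ^ 2 + 1) / q) • 1 := by
  have h0 := q_ne q
  simp only [cubic, add_mul, mul_add, mul_assoc, vm2_mul_v0, v0_mul_v0_mul, v0_mul_v0, mul_neg,
    v2_mul_v2_mul, smul_mul_assoc, mul_smul_comm, smul_zero, mul_one]
  match_scalars <;> field_simp <;> ring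

lemma cubic_mul_vm2 : cubic q c * vm2 q c = c • (v0 q c * vm2 q c) := by
  simp only [cubic, add_mul, mul_assoc, vm2_mul_vm2, mul_zero, zero_add, smul_mul_assoc]

lemma cubic_mul_cubic : cubic q c * cubic q c = (c ^ 3 * (q ^ 2 + 1) / q) • 1 := by
  have h0 := q_ne q
  change (v2 q c * v0 q c * vm2 q c + c • v0 q c) * cubic q c = _
  rw [add_mul, mul_assoc, mul_assoc, vm2_mul_cubic, smul_mul_assoc, v0_mul_cubic]
  simp only [mul_smul_comm, v0_mul_v0_mul, mul_add, smul_zero, vm2_mul_vm2, mul_zero]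
  match_scalars <;> field_simp <;> ring

end CliffordModule

/-! ### Exchange rules in the braided tensor product -/

section WeilAlgebra
variable {k : Type*} [Field k] (q c : k) [IsGeneric q]

namespace Wq

lemma smul_mul (r : k) (a b : Wq q c) : (r • a) * b = r • (a * b) := by
  have h (a b : Uq q ⊗[k] Clq q c) : mulMap q c ((r • a) ⊗ₜ b) = r • mulMap q c (a ⊗ₜ b) := by
    rw [← TensorProduct.smul_tmul', map_smul]
  exact h a b

lemma mul_smul (r : k) (a b : Wq q c) : a * (r • b) = r • (a * b) := by
  have h (a b : Uq q ⊗[k] Clq q c) : mulMap q c (a ⊗ₜ (r • b)) = r • mulMap q c (a ⊗ₜ b) := by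
    rw [TensorProduct.tmul_smul, map_smul]
  exact h a b

lemma add_tmul (x y : Uq q) (v : Clq q c) : tmul q c (x + y) v = tmul q c x v + tmul q c y v :=
  TensorProduct.add_tmul x y v

lemma sub_tmul (x y : Uq q) (v : Clq q c) : tmul q c (x - y) v = tmul q c x v - tmul q c y v :=
  TensorProduct.sub_tmul x y v

lemma smul_tmul (r : k) (x : Uq q) (v : Clq q c) : tmul q c (r • x) v = r • tmul q c x v := rfl

lemma tmul_add (x : Uq q) (v w : Clq q c) : tmul q c x (v + w) = tmul q c x v + tmul q c x w :=
  TensorProduct.tmul_add x v w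

lemma tmul_neg (x : Uq q) (v : Clq q c) : tmul q c x (-v) = -tmul q c x v :=
  TensorProduct.tmul_neg x v

lemma tmul_smul (r : k) (x : Uq q) (v : Clq q c) : tmul q c x (r • v) = r • tmul q c x v :=
  TensorProduct.tmul_smul r x v

lemma tmul_zero (x : Uq q) : tmul q c x 0 = 0 := TensorProduct.tmul_zero _ x

@[elab_as_elim]
lemma induction {P : Wq q c → Prop} (zero : P 0) (tmul : ∀ x v, P (tmul q c x v))
    (add : ∀ a b, P a → P b → P (a + b)) (a : Wq q c) : P a :=
  TensorProduct.induction_on a zero tmul add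

end Wq

variable [CharZero k]

/-- Naturality along `V → Cl_q` and `V → U_q` reduces the braiding to the known matrix on `V ⊗ V`.
-/
lemma sigmaW_ι_adEmbed (x y : Vad k) : sigmaW q c (Clq.ι q c x ⊗ₜ adEmbed q y) =
    TensorProduct.map (adEmbed q) (Clq.ι q c) (sigmaV q (x ⊗ₜ y)) := by
  have h := braid_map q (rhoV q) (rhoV q) (weightV k) (clAct q c) (ad q) (weightUq q)
    (rhoV_E_pow q 3 le_rfl) (clAct_E_pow_three q c) (Clq.ι q c) (adEmbed q)
    (fun u => by ext1 i; ext; simp [clAct_ι]) (ad_F_comp_adEmbed q).symm (vad_ext fun i => by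
      simp only [LinearMap.comp_apply, weightUq_adEmbed, weightV_vb,
        Finsupp.mapRange.linearMap_apply, Finsupp.mapRange_single])
  exact DFunLike.congr_fun h (x ⊗ₜ y)

lemma sigmaW_cubic (y : Uq q) : sigmaW q c (cubic q c ⊗ₜ y) = y ⊗ₜ cubic q c :=
  braid_tmul_of_invariant_left q _ _ _ (clAct_E_pow_three q c) (clAct_E_cubic q c)
    (clAct_K_cubic q c) (weightUq_sum q y)

lemma sigmaW_one_left (y : Uq q) : sigmaW q c (1 ⊗ₜ y) = y ⊗ₜ 1 :=
  braid_tmul_of_invariant_left q _ _ _ (clAct_E_pow_three q c)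
    (by rw [clAct_one]; simp [Uq.counit]) (by rw [clAct_one]; simp [Uq.counit]) (weightUq_sum q y)

lemma sigmaW_casimir_mul (v : Clq q c) (y : Uq q) : sigmaW q c (v ⊗ₜ (casimir q * y)) =
    (LinearMap.mulLeft k (casimir q)).rTensor _ (sigmaW q c (v ⊗ₜ y)) := by
  have h := braid_map q (clAct q c) (ad q) (weightUq q) (clAct q c) (ad q) (weightUq q)
    (clAct_E_pow_three q c) (clAct_E_pow_three q c) LinearMap.id (LinearMap.mulLeft k (casimir q))
    (fun u => by rw [LinearMap.id_comp, LinearMap.comp_id])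
    (LinearMap.ext fun y => (ad_F_casimir_mul q y).symm)
    (LinearMap.ext fun y => weightUq_casimir_mul q y)
  exact DFunLike.congr_fun h (v ⊗ₜ y)

lemma sigmaW_one_right (v : Clq q c) : sigmaW q c (v ⊗ₜ 1) = 1 ⊗ₜ v :=
  braid_tmul_of_invariant_right q _ _ _ (clAct_E_pow_three q c) v
    (by rw [ad_F, mul_one, mul_one, ← mul_assoc, Uq.Kinv_mul_K, one_mul, sub_self])
    (weightUq_eq_single q (by rw [map_one, AddMonoidAlgebra.one_def]))

lemma sigmaW_casimir (v : Clq q c) : sigmaW q c (v ⊗ₜ casimir q) = casimir q ⊗ₜ v := by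
  have h := sigmaW_casimir_mul q c v 1
  rw [sigmaW_one_right] at h
  simpa using h

namespace Wq

lemma tmul_cubic_mul (x y : Uq q) (w : Clq q c) :
    tmul q c x (cubic q c) * tmul q c y w = tmul q c (x * y) (cubic q c * w) := by
  rw [tmul_mul_tmul, sigmaW_cubic]; rfl

lemma mul_casimir_tmul (x : Uq q) (v w : Clq q c) :
    tmul q c x v * tmul q c (casimir q) w = tmul q c (x * casimir q) (v * w) := by
  rw [tmul_mul_tmul, sigmaW_casimir]; rfl

lemma tmul_one_mul (x y : Uq q) (w : Clq q c) :
    tmul q c x 1 * tmul q c y w = tmul q c (x * y) w := by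
  rw [tmul_mul_tmul, sigmaW_one_left]
  change tmul q c (x * y) (1 * w) = _
  rw [one_mul]

lemma mul_tmul_one (x : Uq q) (v w : Clq q c) :
    tmul q c x v * tmul q c 1 w = tmul q c x (v * w) := by
  rw [tmul_mul_tmul, sigmaW_one_right]
  change tmul q c (x * 1) (v * w) = _
  rw [mul_one]

/-- Multiplication by `C` commutes with the braiding, so `C` can be pulled out to the left. This
supplies the associativity needed for centrality. -/
lemma mul_casimir_mul_tmul (x y : Uq q) (v w : Clq q c) :
    tmul q c x v * tmul q c (casimir q * y) w =
      tmul q c (casimir q) 1 * (tmul q c x v * tmul q c y w) := by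
  rw [tmul_mul_tmul, tmul_mul_tmul, sigmaW_casimir_mul]
  induction sigmaW q c (v ⊗ₜ y) with
  | zero => rw [map_zero, map_zero]; exact (mul_zero _).symm
  | add a b ha hb =>
    rw [map_add, map_add, ha, hb]
    exact (mul_add (tmul q c (casimir q) 1) _ _).symm.trans (congrArg _ (map_add _ a b).symm)
  | tmul y' v' =>
    refine Eq.trans ?_ (tmul_one_mul q c (casimir q) (x * y') (v' * w)).symm
    change tmul q c (x * (casimir q * y')) (v' * w) = _
    rw [(casimir_commute q x).symm.left_comm]

end Wq

end WeilAlgebra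

/-! ### Centrality of `C ⊗ 1` and the exchange table for generators -/

section Main
variable {k : Type*} [Field k] (q c : k) [IsGeneric q] [CharZero k]

namespace Wq

lemma tmul_one_mul_mul (u x y : Uq q) (v w : Clq q c) :
    tmul q c u 1 * (tmul q c x v * tmul q c y w) = tmul q c (u * x) v * tmul q c y w := by
  rw [tmul_mul_tmul, tmul_mul_tmul]
  induction sigmaW q c (v ⊗ₜ y) with
  | zero => rw [map_zero, map_zero]; exact mul_zero _
  | add a b ha hb =>
    rw [map_add (TensorProduct.map (LinearMap.mulLeft k (u * x)) _), ← ha, ← hb]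
    exact (congrArg _ (map_add _ a b)).trans (mul_add (tmul q c u 1) _ _)
  | tmul y' v' =>
    refine (tmul_one_mul q c u (x * y') (v' * w)).trans ?_
    rw [← mul_assoc]
    rfl

lemma casimir_tmul_one_mem_center : tmul q c (casimir q) 1 ∈ Set.center (Wq q c) := by
  have hcomm (a : Wq q c) : tmul q c (casimir q) 1 * a = a * tmul q c (casimir q) 1 := by
    induction a using Wq.induction with
    | zero => rw [mul_zero, zero_mul]
    | add a b ha hb => rw [mul_add, add_mul, ha, hb]
    | tmul x v => rw [tmul_one_mul, mul_casimir_tmul, mul_one, (casimir_commute q x).eq]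
  refine ⟨hcomm, fun b d => ?_, fun a b => ?_⟩
  · induction b using Wq.induction with
    | zero => simp only [mul_zero, zero_mul]
    | add a b ha hb => simp only [mul_add, add_mul, ha, hb]
    | tmul x v =>
      induction d using Wq.induction with
      | zero => simp only [mul_zero]
      | add a b ha hb => simp only [mul_add, ha, hb]
      | tmul y w => rw [tmul_one_mul_mul, tmul_one_mul]
  -- Commutativity turns right associativity `(ab)z = a(bz)` into `z(ab) = a(zb)`, which is
  -- `mul_casimir_mul_tmul` on pure tensors.
  · rw [← hcomm, ← hcomm]
    induction a using Wq.induction with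
    | zero => simp only [mul_zero, zero_mul]
    | add a b ha hb => simp only [mul_add, add_mul, ha, hb]
    | tmul x v =>
      induction b using Wq.induction with
      | zero => simp only [mul_zero]
      | add a b ha hb => simp only [mul_add, ha, hb]
      | tmul y w => rw [tmul_one_mul, mul_casimir_mul_tmul]

lemma one_mul' (a : Wq q c) : tmul q c 1 1 * a = a := by
  induction a using Wq.induction with
  | zero => rw [mul_zero]
  | add a b ha hb => rw [mul_add, ha, hb]
  | tmul x v => rw [tmul_one_mul, one_mul]

lemma mul_one' (a : Wq q c) : a * tmul q c 1 1 = a := by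
  induction a using Wq.induction with
  | zero => rw [zero_mul]
  | add a b ha hb => rw [add_mul, ha, hb]
  | tmul x v => rw [mul_tmul_one, mul_one]

lemma one_tmul_one_mem_center : tmul q c 1 1 ∈ Set.center (Wq q c) :=
  ⟨fun a => (one_mul' q c a).trans (mul_one' q c a).symm,
    fun b d => by rw [one_mul', one_mul'], fun a b => by rw [mul_one', mul_one']⟩

instance : IsScalarTower k (Wq q c) (Wq q c) := ⟨smul_mul q c⟩

instance : SMulCommClass k (Wq q c) (Wq q c) := ⟨fun r a b => (mul_smul q c r a b).symm⟩

lemma tmul_generator_mul (x : Uq q) (w : Clq q c) (i j : Fin 3) :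
    tmul q c x (![v2 q c, v0 q c, vm2 q c] i) * tmul q c (![X q, Z q, Y q] j) w =
    ![![q ^ 2 • tmul q c (x * X q) (v2 q c * w), tmul q c (x * Z q) (v2 q c * w),
        (q ^ 2)⁻¹ • tmul q c (x * Y q) (v2 q c * w)],
      ![tmul q c (x * X q) (v0 q c * w) +
          (q ^ 2 - (q ^ 2)⁻¹) • tmul q c (x * Z q) (v2 q c * w),
        tmul q c (x * Z q) (v0 q c * w) -
          ((q ^ 2 - 1) * (q ^ 2 + 1) ^ 2 / q ^ 5) • tmul q c (x * Y q) (v2 q c * w),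
        tmul q c (x * Y q) (v0 q c * w)],
      ![(q ^ 2)⁻¹ • tmul q c (x * X q) (vm2 q c * w) +
          ((1 - q ^ 2) / q) • tmul q c (x * Z q) (v0 q c * w) +
          ((q ^ 2 - 1) ^ 2 * (q ^ 2 + 1) / q ^ 4) • tmul q c (x * Y q) (v2 q c * w),
        tmul q c (x * Z q) (vm2 q c * w) +
          (q ^ 2 - (q ^ 2)⁻¹) • tmul q c (x * Y q) (v0 q c * w),
        q ^ 2 • tmul q c (x * Y q) (vm2 q c * w)]] i j := by
  have hi : ![v2 q c, v0 q c, vm2 q c] i = Clq.ι q c (vb k i) := by fin_cases i <;> rfl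
  rw [hi, ← adEmbed_vb, tmul_mul_tmul, sigmaW_ι_adEmbed, sigmaV_vb]
  fin_cases i <;> fin_cases j <;>
    simp only [Fin.zero_eta, Fin.mk_one, Fin.reduceFinMk, Matrix.cons_val, map_add, map_sub,
      map_smul, TensorProduct.map_tmul, adEmbed_vb] <;> rfl

end Wq

end Main

/-! ### The square of the Dirac element -/

section Square
variable {k : Type*} [Field k] (q c : k) [IsGeneric q] [CharZero k]

open Wq Uq in
-- The bracket multiplied by `C` is `(Aγ)/c`, by the formulas for `v₂γ`, `v₀γ`, `v₋₂γ`; this shape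
-- prepares the cancellation in `Dq_sq`.
lemma linear_part_sq (hc : c ≠ 0) :
    (tmul q c (X q) (vm2 q c) + (q / (1 + q ^ 2)) • tmul q c (Z q) (v0 q c) +
        (q ^ 2)⁻¹ • tmul q c (Y q) (v2 q c)) *
      (tmul q c (X q) (vm2 q c) + (q / (1 + q ^ 2)) • tmul q c (Z q) (v0 q c) +
        (q ^ 2)⁻¹ • tmul q c (Y q) (v2 q c)) =
    ((q ^ 2 - 1) ^ 2 / (q * (q ^ 2 + 1))) • tmul q c (casimir q) 1 *
      (tmul q c (X q) (v0 q c * vm2 q c) + (q / (1 + q ^ 2)) • tmul q c (Z q)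
          (-((q ^ 2 + 1) / q) • (v2 q c * vm2 q c) + (c * (q ^ 2 + 1) / q) • 1) +
        (q ^ 2)⁻¹ • tmul q c (Y q) (v2 q c * v0 q c)) +
      (c * (q ^ 2 - 1) ^ 2 / (q * (q ^ 2 + 1))) • tmul q c (casimir q * casimir q) 1 -
      (c * q * (q ^ 2 + 1) / (q ^ 2 - 1) ^ 2) • tmul q c 1 1 := by
  have h0 := q_ne q
  have h1 := q_sq_sub_one_ne q
  have h2 := q_sq_add_one_ne q
  have h3 : 1 + q ^ 2 ≠ 0 := by rwa [add_comm]
  have h (x : Uq q) (w : Clq q c) := tmul_generator_mul q c x w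
  simp only [Fin.forall_fin_succ, Fin.forall_fin_zero, Matrix.cons_val] at h
  simp at h
  simp only [forall_and] at h
  obtain ⟨⟨h00, h01, h02⟩, ⟨h10, h11, h12⟩, h20, h21, h22⟩ := h
  simp only [add_mul, mul_add, Wq.smul_mul, Wq.mul_smul, h00, h01, h02, h10, h11, h12, h20, h21,
    h22, tmul_one_mul, v2_mul_v2, vm2_mul_vm2, v0_mul_v2, v0_mul_v0, vm2_mul_v0, vm2_mul_v2,
    Wq.tmul_add, Wq.tmul_smul, Wq.tmul_neg, Wq.tmul_zero]
  -- Both sides are brought to ordered monomials in `F, E, K^{±1}` tensor ordered Clifford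
  -- monomials, and coefficients are compared.
  simp only [X, Y, Z, casimir_eq, sub_mul, mul_sub, add_mul, mul_add, mul_smul_comm, smul_mul_assoc,
    mul_assoc, K_mul_E, K_mul_F, Kinv_mul_E, E_mul_F, E_mul_F_mul,
    K_mul_F_mul, Kinv_mul_F_mul, K_mul_Kinv, Kinv_mul_K,
    mul_one, one_mul, Wq.add_tmul, Wq.sub_tmul, Wq.smul_tmul]
  match_scalars
  all_goals (field_simp; try ring)

open Wq Uq in
lemma Dq_sq (hc : c ≠ 0) : Dq q c * Dq q c =
    ((q ^ 2 + 1) * (q ^ 2 - 1) ^ 2 / (4 * q ^ 3 * c)) • tmul q c (casimir q ^ 2) 1 -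
      (q * (q ^ 2 + 1) / ((q ^ 2 - 1) ^ 2 * c)) • tmul q c 1 1 := by
  have h0 := q_ne q
  have h1 := q_sq_sub_one_ne q
  have h2 := q_sq_add_one_ne q
  have h3 : 1 + q ^ 2 ≠ 0 := by rwa [add_comm]
  have hA := linear_part_sq q c hc
  have hD : Dq q c = (1 / c) • (tmul q c (X q) (vm2 q c) +
      (q / (1 + q ^ 2)) • tmul q c (Z q) (v0 q c) + (q ^ 2)⁻¹ • tmul q c (Y q) (v2 q c)) -
      ((q ^ 2 - 1) ^ 2 / (2 * q * (q ^ 2 + 1) * c ^ 2)) •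
        tmul q c (casimir q) (cubic q c) := rfl
  rw [hD, sub_mul, mul_sub, mul_sub]
  simp only [Wq.smul_mul, Wq.mul_smul]
  rw [hA]
  -- Both cross terms become the same multiple of `C · (Aγ)` and cancel the part of `A²` linear in
  -- the bracket.
  simp only [add_mul, mul_add, Wq.smul_mul, Wq.mul_smul, tmul_one_mul, tmul_cubic_mul,
    mul_casimir_tmul, (casimir_commute q _).eq, v2_mul_cubic, v0_mul_cubic,
    vm2_mul_cubic, cubic_mul_v2,
    cubic_mul_v0, cubic_mul_vm2, cubic_mul_cubic, pow_two (casimir q),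
    Wq.tmul_add, Wq.tmul_smul]
  match_scalars
  all_goals (field_simp; try ring)

end Square

end QWeil

/-! ### The formula for the square and its centrality -/

theorem mainTheorem2 {k : Type*} [Field k] [CharZero k] (q c : k) [QWeil.IsGeneric q]
    (hc : c ≠ 0) :
    QWeil.Dq q c * QWeil.Dq q c =
        ((q ^ 2 + 1) * (q ^ 2 - 1) ^ 2 / (4 * q ^ 3 * c)) •
            QWeil.Wq.tmul q c (QWeil.casimir q ^ 2) 1 -
          (q * (q ^ 2 + 1) / ((q ^ 2 - 1) ^ 2 * c)) • QWeil.Wq.tmul q c 1 1 ∧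
      QWeil.Dq q c * QWeil.Dq q c ∈ Set.center (QWeil.Wq q c) := by
  have h := QWeil.Dq_sq q c hc
  refine ⟨h, ?_⟩
  have hC := QWeil.Wq.casimir_tmul_one_mem_center q c
  have hC2 : QWeil.Wq.tmul q c (QWeil.casimir q ^ 2) 1 ∈ Set.center (QWeil.Wq q c) := by
    rw [pow_two, ← QWeil.Wq.tmul_one_mul]
    exact Set.mul_mem_center hC hC
  rw [h, sub_eq_add_neg]
  exact Set.add_mem_center (Set.smul_mem_center _ hC2)
    (Set.neg_mem_center (Set.smul_mem_center _ (QWeil.Wq.one_tmul_one_mem_center q c)))
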